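/- An affine $\mathbb{Z}$-VASS is a triple $\mathcal{V}=(d,Q,T)$ where $d\in\mathbb{N}$, $Q$ is a finite set of control-states and $T\subseteq Q\times\mathbb{Z}^{d\times d}\times\mathbb{Z}^d\times Q$ is a finite set of transitions. A configuration is a pair $p(\mathbf{u})$ with $p\in Q$, $\mathbf{u}\in\mathbb{Z}^d$. A transition $(p,\mathbf{A},\mathbf{b},q)$ leads from $p(\mathbf{u})$ to $q(\mathbf{A}\mathbf{u}+\mathbf{b})$, for every $\mathbf{u}\in\mathbb{Z}^d$, and $p(\mathbf{u})\xrightarrow{*}q(\mathbf{v})$ means that some finite (possibly empty) sequence of transitions of $T$ leads from $p(\mathbf{u})$ to $q(\mathbf{v})$. The system $\mathcal{V}$ is an afmp-$\mathbb{Z}$-VASS (has the finite-monoid property) if the monoid generated under matrix multiplication by the matrices $\mathbf{A}$ occurring in its transitions, together with the identity matrix, is finite. The reachability problem for afmp-$\mathbb{Z}$-VASS is decidable: there is an algorithm (a total computable function on finite descriptions of affine $\mathbb{Z}$-VASS with two configurations) such that for every afmp-$\mathbb{Z}$-VASS $\mathcal{V}=(d,Q,T)$ and all configurations $p(\mathbf{u}),q(\mathbf{v})$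 of $\mathcal{V}$, the algorithm accepts the description of $(\mathcal{V},p(\mathbf{u}),q(\mathbf{v}))$ if and only if $p(\mathbf{u})\xrightarrow{*}q(\mathbf{v})$. -/

import Mathlib

/-- A transition `(p, A, b, q)` in dimension `d` over the control-states `Q`. -/
structure AffineTransition (d : ℕ) (Q : Type) where
  src : Q
  mat : Matrix (Fin d) (Fin d) ℤ
  vec : Fin d → ℤ
  tgt : Q

/-- The affine transformation `x ↦ A x + b` of a transition. -/
def AffineTransition.apply {d : ℕ} {Q : Type} (t : AffineTransition d Q) (x : Fin d → ℤ) :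
    Fin d → ℤ :=
  Matrix.mulVec t.mat x + t.vec

/-- An affine integer vector addition system with states `(d, Q, T)`. -/
structure AffineZVASS where
  dim : ℕ
  State : Type
  finite_state : Finite State
  transitions : Finset (AffineTransition dim State)

namespace AffineZVASS

/-- Configurations `q(v)`. -/
abbrev Config (V : AffineZVASS) : Type := V.State × (Fin V.dim → ℤ)

/-- One step along the transition `t`. -/
def Step (V : AffineZVASS) (t : AffineTransition V.dim V.State) (c c' : V.Config) : Prop :=
  c.1 = t.src ∧ c'.1 = t.tgt ∧ c'.2 = t.apply c.2

/-- Running along a sequence of transitions. -/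
def Run (V : AffineZVASS) : List (AffineTransition V.dim V.State) → V.Config → V.Config → Prop
  | [], c, c' => c = c'
  | t :: w, c, c' => ∃ c₁ : V.Config, V.Step t c c₁ ∧ V.Run w c₁ c'

/-- The reachability relation. -/
def Reaches (V : AffineZVASS) (c c' : V.Config) : Prop :=
  ∃ w : List (AffineTransition V.dim V.State), (∀ t ∈ w, t ∈ V.transitions) ∧ V.Run w c c'

/-- The matrix monoid generated by the matrices of the transitions. -/
def monoid (V : AffineZVASS) : Submonoid (Matrix (Fin V.dim) (Fin V.dim) ℤ) :=
  Submonoid.closure {A | ∃ t ∈ V.transitions, t.mat = A}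

/-- The finite-monoid property: `V` is an afmp-ℤ-VASS. -/
def HasFiniteMonoid (V : AffineZVASS) : Prop :=
  (V.monoid : Set (Matrix (Fin V.dim) (Fin V.dim) ℤ)).Finite

end AffineZVASS

/-- Finite descriptions of inputs: the dimension, the number of control-states, a list of
transitions (source, rows of the matrix, vector, target), and the two configurations. -/
abbrev ReachCode : Type :=
  ℕ × ℕ × List (ℕ × List (List ℤ) × List ℤ × ℕ) × (ℕ × List ℤ) × (ℕ × List ℤ)

namespace AffineZVASS

/-- The choices made when an affine ℤ-VASS is written down: a numbering of its control-states and
a list of its finitely many transitions, in any order. -/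
structure Presentation (V : AffineZVASS) where
  numStates : ℕ
  numbering : V.State ≃ Fin numStates
  list : List (AffineTransition V.dim V.State)
  mem_list : ∀ t, t ∈ list ↔ t ∈ V.transitions

/-- The code of a transition. -/
def Presentation.codeTransition {V : AffineZVASS} (P : V.Presentation)
    (t : AffineTransition V.dim V.State) : ℕ × List (List ℤ) × List ℤ × ℕ :=
  ((P.numbering t.src : ℕ), List.ofFn (fun i => List.ofFn (fun j => t.mat i j)),
    List.ofFn t.vec, (P.numbering t.tgt : ℕ))

/-- The code of a configuration. -/
def Presentation.codeConfig {V : AffineZVASS} (P : V.Presentation) (c : V.Config) : ℕ × List ℤ :=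
  ((P.numbering c.1 : ℕ), List.ofFn c.2)

/-- The code of the input `(V, c, c')` of the reachability problem. -/
def Presentation.code {V : AffineZVASS} (P : V.Presentation) (c c' : V.Config) : ReachCode :=
  (V.dim, P.numStates, P.list.map P.codeTransition, P.codeConfig c, P.codeConfig c')

end AffineZVASS

/-! Deciding reachability splits into two problems: computing the matrix monoid by a search that
halts on every input, and bounding the length of runs once the monoid is known.

The search enumerates products of matrices by word length. It stops when the list is closed under
one more multiplication, or when it meets a matrix `A` that is idempotent modulo 3 with `A ^ (n + 1)
≠ A ^ n`. By a Minkowski-type argument (`pow_card_succ_eq_of_torsion`) such an `A` has infinitely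
many distinct powers, so it never occurs in a finite monoid. If no such `A` ever occurs, some power
of each product, with a uniform exponent, is idempotent modulo 3, so all products satisfy one
identity `x ^ (N + e) = x ^ N`. A Burnside theorem for finitely generated linear monoids
(`finite_range_wordProd`) then makes the set of products finite, and the search stops by closure
(`exists_saturated`).

With the finite list `S` of products at hand, a run from `p(u)` to `q(v)` becomes a walk on the
pairs (state, matrix), the matrix being the product of what remains to be applied. It starts at some
`(p, A)`, ends at `(q, 1)`, and has total weight `v - A u`. A walk is a short skeleton visiting all
its nodes plus short cycles. A zero-sum argument in the style of Steinitz keeps boundedly many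
cycles of the same total weight (`Walk.exists_short`), so exploring runs of bounded length suffices.
-/

/-! ### Words in endomorphisms: reduction to an invariant subspace and its quotient. -/

section Burnside

open Module

variable {V : Type} [AddCommGroup V] [Module ℂ V]

/-- The product of the word `w` in the generators `g`. -/
def wordProd {α R : Type*} [Monoid R] (g : α → R) (w : List α) : R := (w.map g).prod

@[simp] theorem wordProd_nil {α R : Type*} [Monoid R] (g : α → R) : wordProd g [] = 1 := rfl

@[simp] theorem wordProd_cons {α R : Type*} [Monoid R] (g : α → R) (a : α) (w : List α) :
    wordProd g (a :: w) = g a * wordProd g w := by simp [wordProd]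

@[simp] theorem wordProd_append {α R : Type*} [Monoid R] (g : α → R) (w w' : List α) :
    wordProd g (w ++ w') = wordProd g w * wordProd g w' := by simp [wordProd]

theorem exists_wordProd_pow {α R : Type*} [Monoid R] (g : α → R) (w : List α) (k : ℕ) :
    ∃ w', wordProd g w' = wordProd g w ^ k := by
  induction k with
  | zero => exact ⟨[], by simp⟩
  | succ k ih =>
    obtain ⟨w', h⟩ := ih
    exact ⟨w' ++ w, by simp [h, pow_succ]⟩

theorem map_wordProd {α R S F : Type*} [Monoid R] [Monoid S] [FunLike F R S]
    [MonoidHomClass F R S] (φ : F) (g : α → R) (w : List α) :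
    φ (wordProd g w) = wordProd (fun a => φ (g a)) w := by
  induction w with
  | nil => simp
  | cons a w ih => simp [ih]

/-- A torsion middle factor acting trivially on both sides of an invariant subspace can be cut. -/
theorem mul_mul_eq_mul_of_torsion (W : Submodule ℂ V) (X U Z : End ℂ V)
    {N e : ℕ} (he : 0 < e) (hp : U ^ (N + e) = U ^ N) (hU : ∀ x ∈ W, U x ∈ W)
    (h1 : ∀ x ∈ W, X (U x) = X x) (h2 : ∀ v, U (Z v) - Z v ∈ W) : X * (U * Z) = X * Z := by
  ext v
  set y := U (Z v) - Z v with hy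
  have hyW : y ∈ W := h2 v
  have hpow : ∀ k : ℕ, ∀ x ∈ W, X ((U ^ k) x) = X x := by
    intro k
    induction k with
    | zero => simp
    | succ k ih =>
      intro x hx
      rw [pow_succ, Module.End.mul_apply, ih _ (hU x hx), h1 x hx]
  -- The orbit grows linearly with increment `X y`; eventual periodicity of `U` then gives `e • X y
  -- = 0`, hence `X y = 0` in characteristic zero.
  have hlin : ∀ k : ℕ, X ((U ^ k) (Z v)) = X (Z v) + (k : ℂ) • X y := by
    intro k
    induction k with
    | zero => simp
    | succ k ih =>
      have : U (Z v) = Z v + y := by rw [hy]; abel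
      rw [pow_succ, Module.End.mul_apply, this, map_add, map_add, ih, hpow k y hyW]
      push_cast
      rw [add_smul, one_smul, add_assoc]
  have h := hlin (N + e)
  rw [hp, hlin N] at h
  have h0 : (e : ℂ) • X y = 0 := by
    push_cast at h
    rw [add_smul, ← add_assoc] at h
    simpa using h.symm
  have hX : X y = 0 := by
    rcases smul_eq_zero.1 h0 with h' | h'
    · exact absurd (by exact_mod_cast h') he.ne'
    · exact h'
  have := hlin 1
  simpa [hX] using this

theorem finite_range_of_shorten {α β : Type*} [Finite α] (f : List α → β) (K : ℕ)
    (h : ∀ w : List α, K < w.length → ∃ w' : List α, w'.length < w.length ∧ f w' = f w) :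
    (Set.range f).Finite := by
  have key : ∀ n (w : List α), w.length = n → ∃ w', w'.length ≤ K ∧ f w' = f w := by
    intro n
    induction n using Nat.strong_induction_on with
    | _ n ih =>
      intro w hw
      by_cases hK : w.length ≤ K
      · exact ⟨w, hK, rfl⟩
      · obtain ⟨w1, hl, hf⟩ := h w (not_le.1 hK)
        obtain ⟨w2, h2, hf2⟩ := ih _ (hw ▸ hl) w1 rfl
        exact ⟨w2, h2, hf2.trans hf⟩
  refine ((List.finite_length_le α K).image f).subset ?_
  rintro _ ⟨w, rfl⟩
  obtain ⟨w', h1, h2⟩ := key _ w rfl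
  exact ⟨w', h1, h2⟩

theorem wordProd_mem {α : Type} (g : α → End ℂ V) (W : Submodule ℂ V)
    (hW : ∀ a, ∀ x ∈ W, g a x ∈ W) (w : List α) : ∀ x ∈ W, wordProd g w x ∈ W := by
  induction w with
  | nil => simp
  | cons a w ih => intro x hx; simpa using hW a _ (ih x hx)

/-- In block triangular form only the off-diagonal block could be infinite. A long word has two cut
points at which the prefixes agree on `W` and the suffixes agree modulo `W`; the factor between them
can be deleted by `mul_mul_eq_mul_of_torsion`. -/
theorem finite_range_wordProd_of_invariant {α : Type} [Finite α] (g : α → End ℂ V)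
    (W : Submodule ℂ V) (hW : ∀ a, ∀ x ∈ W, g a x ∈ W) {N e : ℕ} (he : 0 < e)
    (hp : ∀ w, wordProd g w ^ (N + e) = wordProd g w ^ N)
    (h1 : (Set.range fun w => (wordProd g w).comp W.subtype).Finite)
    (h2 : (Set.range fun w => W.mkQ.comp (wordProd g w)).Finite) :
    (Set.range (wordProd g)).Finite := by
  have hf := h1.prod h2
  apply finite_range_of_shorten (wordProd g) hf.toFinset.card
  intro w hw
  have hmaps : ∀ i ∈ Finset.range (w.length),
      ((wordProd g (w.take i)).comp W.subtype, W.mkQ.comp (wordProd g (w.drop i))) ∈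
        hf.toFinset := by
    intro i _
    simp
  obtain ⟨i, hi, j, hj, hij, heq⟩ := Finset.exists_ne_map_eq_of_card_lt_of_maps_to
    (by simpa using hw) hmaps
  wlog hlt : i < j generalizing i j
  · exact this j hj i hi hij.symm heq.symm (lt_of_le_of_ne (not_lt.1 hlt) hij.symm)
  simp only [Prod.mk.injEq] at heq
  obtain ⟨e1, e2⟩ := heq
  have hjl : j < w.length := by simpa using hj
  have hdrop : w.drop i = (w.drop i).take (j - i) ++ w.drop j := by
    conv_lhs => rw [← List.take_append_drop (j - i) (w.drop i)]
    rw [List.drop_drop]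
    congr 2; omega
  have htake : w.take j = w.take i ++ (w.drop i).take (j - i) := by
    have : j = i + (j - i) := by omega
    conv_lhs => rw [this]
    rw [List.take_add]
  refine ⟨w.take i ++ w.drop j, ?_, ?_⟩
  · simp; omega
  · conv_rhs => rw [← List.take_append_drop i w, hdrop]
    rw [wordProd_append, wordProd_append, wordProd_append]
    refine (mul_mul_eq_mul_of_torsion W _ _ _ he (hp _) (wordProd_mem g W hW _) ?_ ?_).symm
    · intro x hx
      have := LinearMap.congr_fun e1 ⟨x, hx⟩
      rw [htake, wordProd_append] at this
      simpa using this.symm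
    · intro v
      have := LinearMap.congr_fun e2 v
      rw [hdrop, wordProd_append] at this
      simp only [LinearMap.comp_apply, Module.End.mul_apply, Submodule.mkQ_apply] at this
      exact (Submodule.Quotient.eq W).1 this

end Burnside

/-! ### Burnside's theorem: trace arguments and induction on the dimension. -/

section Burnside

open Module

variable {V : Type} [AddCommGroup V] [Module ℂ V]

/-- Vanishing traces of positive powers exclude the eigenvalue 1. A polynomial in `E` without
constant term yields an idempotent fixing `v`; its trace is zero, so it is zero. -/
theorem eq_zero_of_trace_pow_eq_zero [FiniteDimensional ℂ V] (E : End ℂ V)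
    (hE : ∀ k, LinearMap.trace ℂ V (E ^ (k + 1)) = 0) (v : V) (hv : E v = v) : v = 0 := by
  open Polynomial in
  obtain ⟨q, hq, hnd⟩ := Polynomial.exists_eq_pow_rootMultiplicity_mul_and_not_dvd
    (LinearMap.charpoly E) (LinearMap.charpoly_monic E).ne_zero 0
  set a := Polynomial.rootMultiplicity 0 (LinearMap.charpoly E)
  rw [map_zero, sub_zero] at hq hnd
  have hc : q.coeff 0 ≠ 0 := fun h => hnd (Polynomial.X_dvd_iff.2 h)
  -- Since `q` has nonzero constant term, `X` is invertible modulo `q`. By Cayley–Hamilton, `F = E *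
  -- r(E)` then acts as the identity on the range of `E ^ a`.
  obtain ⟨r, hr⟩ : ∃ r : ℂ[X], X ^ a * (X * r) =
      X ^ a - C ((q.coeff 0)⁻¹) * LinearMap.charpoly E := by
    refine ⟨C (-(q.coeff 0)⁻¹) * q.divX, ?_⟩
    have h1 : C ((q.coeff 0)⁻¹) * C (q.coeff 0) = (1 : ℂ[X]) := by
      rw [← C_mul, inv_mul_cancel₀ hc, C_1]
    have h2 := Polynomial.X_mul_divX_add q
    rw [hq, C_neg]
    linear_combination X ^ a * h1 - C ((q.coeff 0)⁻¹) * X ^ a * h2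
  obtain ⟨F, hF⟩ : ∃ F : End ℂ V, F = aeval E (X * r) := ⟨_, rfl⟩
  obtain ⟨G, hG⟩ : ∃ G : End ℂ V, G = aeval E r := ⟨_, rfl⟩
  have hEf : E ^ a * F = E ^ a := by
    have := congrArg (aeval E) hr
    rw [hF]
    simpa [LinearMap.aeval_self_charpoly] using this
  have hXF : F = E * G := by rw [hF, hG, map_mul, aeval_X]
  have hEG : Commute E G := by
    rw [hG]
    simpa using (Commute.all (X : ℂ[X]) r).map (aeval (R := ℂ) E)
  have hFF : F ^ (a + 1) * F = F ^ (a + 1) := by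
    have h2 : F ^ (a + 1) = G ^ (a + 1) * E * E ^ a := by
      rw [hXF, hEG.mul_pow, (hEG.pow_pow (a + 1) (a + 1)).eq, pow_succ' E, mul_assoc]
    rw [h2, mul_assoc, hEf]
  have hidem : IsIdempotentElem (F ^ (a + 1)) := by
    have : ∀ k, F ^ (a + 1) * F ^ k = F ^ (a + 1) := by
      intro k
      induction k with
      | zero => simp
      | succ k ih => rw [pow_succ F k, ← mul_assoc, ih, hFF]
    exact this _
  have htr : ∀ p : ℂ[X], LinearMap.trace ℂ V (aeval E (X * p)) = 0 := by
    intro p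
    induction p using Polynomial.induction_on' with
    | add p q hp hq => rw [mul_add, map_add, map_add, hp, hq, add_zero]
    | monomial n c =>
      rw [X_mul_monomial, aeval_monomial, ← Algebra.smul_def, map_smul, hE, smul_zero]
  have hP : F ^ (a + 1) = 0 := by
    apply LinearMap.IsIdempotentElem.eq_zero_of_trace_eq_zero hidem
    have : F ^ (a + 1) = aeval E (X * (r * (X * r) ^ a)) := by
      rw [hF, ← map_pow, pow_succ', mul_assoc]
    rw [this, htr]
  have hpow : ∀ k, (E ^ k) v = v := by
    intro k
    induction k with
    | zero => simp
    | succ k ih => rw [pow_succ, Module.End.mul_apply, hv, ih]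
  have hcF : E ^ a * F = F * E ^ a := by
    rw [hXF]
    exact (((Commute.refl E).mul_right hEG).pow_left a).eq
  have hFv : F v = v := by
    have := LinearMap.congr_fun hEf v
    rw [hcF, Module.End.mul_apply, hpow] at this
    exact this
  have hFk : ∀ k, (F ^ k) v = v := by
    intro k
    induction k with
    | zero => simp
    | succ k ih => rw [pow_succ, Module.End.mul_apply, hFv, ih]
  rw [← hFk (a + 1), hP, LinearMap.zero_apply]

/-- All eigenvalues are roots of `X ^ (N + e) - X ^ N`, and the trace is a sum of at most `finrank ℂ
V` of them. -/
theorem finite_trace_of_pow_eq [FiniteDimensional ℂ V] (N e : ℕ) (he : 0 < e) :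
    {z : ℂ | ∃ X : End ℂ V, X ^ (N + e) = X ^ N ∧ LinearMap.trace ℂ V X = z}.Finite := by
  set R : Finset ℂ := (Polynomial.X ^ (N + e) - Polynomial.X ^ N : Polynomial ℂ).roots.toFinset
  have hne : (Polynomial.X ^ (N + e) - Polynomial.X ^ N : Polynomial ℂ) ≠ 0 := by
    intro h
    have := congrArg (fun p => Polynomial.coeff p (N + e)) h
    simp [Polynomial.coeff_X_pow, he.ne'] at this
  refine ((List.finite_length_le R (finrank ℂ V)).image
    (fun l => (l.map (Subtype.val)).sum)).subset ?_
  rintro z ⟨X, hX, rfl⟩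
  have hsum := Module.End.trace_eq_sum_roots_charpoly_of_splits
    (IsAlgClosed.splits (LinearMap.charpoly X))
  have hroot : ∀ μ ∈ (LinearMap.charpoly X).roots.toList, μ ∈ R := by
    intro μ hμ
    have h1 : X.HasEigenvalue μ := by
      rw [Module.End.hasEigenvalue_iff_isRoot_charpoly]
      exact (Polynomial.mem_roots'.1 (by simpa using hμ)).2
    obtain ⟨v, hv⟩ := h1.exists_hasEigenvector
    have h2 := LinearMap.congr_fun hX v
    rw [hv.pow_apply, hv.pow_apply, ← sub_eq_zero, ← sub_smul] at h2
    have h3 := (smul_eq_zero.1 h2).resolve_right hv.2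
    simp only [R, Multiset.mem_toFinset, Polynomial.mem_roots', Polynomial.IsRoot.def]
    exact ⟨hne, by simpa using h3⟩
  refine ⟨(LinearMap.charpoly X).roots.toList.attachWith _ hroot, ?_, ?_⟩
  · simp only [Set.mem_ofPred_eq, List.length_attachWith, Multiset.length_toList]
    exact (Polynomial.card_roots' _).trans (LinearMap.charpoly_natDegree X).le
  · simp only [hsum]
    rw [List.attachWith_map_subtype_val, Multiset.sum_toList]

/-- Irreducibility makes the trace form nondegenerate on the span of the words. A word is thus
determined by its traces against a finite spanning family of words, and each such trace takes
finitely many values. -/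
theorem finite_range_wordProd_of_irreducible [FiniteDimensional ℂ V] {α : Type} (g : α → End ℂ V)
    {N e : ℕ} (he : 0 < e) (hp : ∀ w, wordProd g w ^ (N + e) = wordProd g w ^ N)
    (hirr : ∀ W : Submodule ℂ V, (∀ a, ∀ x ∈ W, g a x ∈ W) → W = ⊥ ∨ W = ⊤) :
    (Set.range (wordProd g)).Finite := by
  set A := Submodule.span ℂ (Set.range (wordProd g)) with hA
  obtain ⟨f, hf, hspan, -⟩ := Submodule.exists_fun_fin_finrank_span_eq ℂ (Set.range (wordProd g))
  have hmul : ∀ x ∈ A, ∀ y ∈ A, x * y ∈ A := by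
    intro x hx y hy
    have h := Submodule.mul_mem_mul hx hy
    rw [hA, Submodule.span_mul_span] at h
    refine Submodule.span_mono ?_ h
    rintro _ ⟨_, ⟨w, rfl⟩, _, ⟨w', rfl⟩, rfl⟩
    exact ⟨w ++ w', by simp⟩
  have hword : ∀ w, wordProd g w ∈ A := fun w => Submodule.subset_span ⟨w, rfl⟩
  have hone : (1 : End ℂ V) ∈ A := hword []
  have hpow : ∀ x ∈ A, ∀ k : ℕ, x ^ k ∈ A := by
    intro x hx k
    induction k with
    | zero => simpa using hone
    | succ k ih => rw [pow_succ]; exact hmul _ ih _ hx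
  -- If `Z v ≠ 0`, the invariant subspace `A (Z v)` is everything, so some `P * Z` fixes `v`
  -- although all its positive powers have trace zero.
  have hinj : ∀ Z : End ℂ V, Z ∈ A → (∀ P ∈ A, LinearMap.trace ℂ V (Z * P) = 0) → Z = 0 := by
    intro Z hZA hZ
    by_contra hne
    obtain ⟨v, hv⟩ : ∃ v, Z v ≠ 0 := by
      by_contra! h
      exact hne (LinearMap.ext h)
    rcases hirr (A.map (LinearMap.applyₗ (Z v))) (by
      rintro a _ ⟨P, hP, rfl⟩
      refine ⟨g a * P, hmul _ ?_ _ hP, by simp⟩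
      simpa using hword [a]) with h | h
    · have : Z v ∈ A.map (LinearMap.applyₗ (Z v)) := ⟨1, hone, by simp⟩
      rw [h] at this
      exact hv (by simpa using this)
    · obtain ⟨P, hP, hPv⟩ : v ∈ A.map (LinearMap.applyₗ (Z v)) := h ▸ Submodule.mem_top
      refine hv ?_
      have hv0 : v = 0 := by
        refine eq_zero_of_trace_pow_eq_zero (P * Z) ?_ v (by simpa using hPv)
        intro k
        rw [pow_succ, ← mul_assoc, LinearMap.trace_mul_comm]
        exact hZ _ (hmul _ (hpow _ (hmul _ hP _ hZA) k) _ hP)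
      rw [hv0, map_zero]
  have hfin := Set.Finite.pi' (fun _ : Fin (finrank ℂ A) => finite_trace_of_pow_eq (V := V) N e he)
  refine Set.Finite.of_finite_image
    (f := fun X : End ℂ V => fun i => LinearMap.trace ℂ V (X * f i)) (hfin.subset ?_) ?_
  · rintro _ ⟨_, ⟨w, rfl⟩, rfl⟩ i
    obtain ⟨w', hw'⟩ := hf i
    exact ⟨_, hp (w ++ w'), by simp [hw']⟩
  · rintro _ ⟨w, rfl⟩ _ ⟨w', rfl⟩ h
    rw [← sub_eq_zero]
    refine hinj _ (sub_mem (hword w) (hword w')) ?_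
    intro P hP
    rw [hA, ← hspan] at hP
    induction hP using Submodule.span_induction with
    | mem x hx =>
      obtain ⟨i, rfl⟩ := hx
      have := congrFun h i
      rw [sub_mul, map_sub, sub_eq_zero]
      exact this
    | zero => simp
    | add x y _ _ hx hy => rw [mul_add, map_add, hx, hy, add_zero]
    | smul c x _ hx => rw [mul_smul_comm, map_smul, hx, smul_zero]

/-- A finitely generated monoid of endomorphisms with bounded index and period is finite. -/
theorem finite_range_wordProd {α : Type} [Finite α] {N e : ℕ} (he : 0 < e) :
    ∀ (n : ℕ) (V : Type) [AddCommGroup V] [Module ℂ V] [FiniteDimensional ℂ V],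
      finrank ℂ V = n → ∀ g : α → End ℂ V,
      (∀ w, wordProd g w ^ (N + e) = wordProd g w ^ N) → (Set.range (wordProd g)).Finite := by
  intro n
  induction n using Nat.strong_induction_on with
  | _ n ih =>
    intro V _ _ _ hn g hp
    by_cases hirr : ∀ W : Submodule ℂ V, (∀ a, ∀ x ∈ W, g a x ∈ W) → W = ⊥ ∨ W = ⊤
    · exact finite_range_wordProd_of_irreducible g he hp hirr
    push Not at hirr
    obtain ⟨W, hW, hbot, htop⟩ := hirr
    refine finite_range_wordProd_of_invariant g W hW he hp ?_ ?_
    · set gW : α → End ℂ W := fun a => (g a).restrict (hW a)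
      have hcoe : ∀ w (x : W), ((wordProd gW w x : W) : V) = wordProd g w x := by
        intro w
        induction w with
        | nil => simp
        | cons a w ihw => intro x; simp [gW, ihw]
      have hcoeP : ∀ w k (x : W), (((wordProd gW w ^ k) x : W) : V) = (wordProd g w ^ k) x := by
        intro w k
        induction k with
        | zero => simp
        | succ k ihk => intro x; simp [pow_succ, ihk, hcoe]
      have := ih (finrank ℂ W) (hn ▸ Submodule.finrank_lt htop) W rfl gW (by
        intro w
        ext x
        rw [hcoeP, hcoeP, hp])
      refine (this.image fun f => W.subtype.comp f).subset ?_
      rintro _ ⟨w, rfl⟩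
      refine ⟨_, ⟨w, rfl⟩, ?_⟩
      ext x
      simp [hcoe]
    · set gQ : α → End ℂ (V ⧸ W) := fun a => W.mapQ W (g a) (hW a)
      have hcoe : ∀ w (x : V), wordProd gQ w (W.mkQ x) = W.mkQ (wordProd g w x) := by
        intro w
        induction w with
        | nil => simp
        | cons a w ihw =>
          intro x
          rw [wordProd_cons, Module.End.mul_apply, ihw, wordProd_cons, Module.End.mul_apply]
          simp [gQ]
      have hcoeP : ∀ w k (x : V),
          (wordProd gQ w ^ k) (W.mkQ x) = W.mkQ ((wordProd g w ^ k) x) := by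
        intro w k
        induction k with
        | zero => simp
        | succ k ihk =>
          intro x
          rw [pow_succ, Module.End.mul_apply, hcoe, ihk, pow_succ, Module.End.mul_apply]
      have hlt : finrank ℂ (V ⧸ W) < n := by
        have h1 := Submodule.finrank_quotient_add_finrank W
        have h2 : 0 < finrank ℂ W := by
          rw [Nat.pos_iff_ne_zero, Ne, Submodule.finrank_eq_zero]; exact hbot
        omega
      have := ih _ hlt (V ⧸ W) rfl gQ (by
        intro w
        ext x
        simp only [LinearMap.comp_apply]
        rw [hcoeP, hcoeP, hp])
      refine (this.image fun f => f.comp W.mkQ).subset ?_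
      rintro _ ⟨w, rfl⟩
      refine ⟨_, ⟨w, rfl⟩, ?_⟩
      ext x
      exact hcoe w x

end Burnside

/-! ### Integer matrices: torsion and reduction modulo 3. -/

section IntegerMatrices

open Module

variable {n : ℕ}

/-- The embedding of integer matrices into complex endomorphisms. -/
noncomputable def intMatrixToEnd (n : ℕ) :
    Matrix (Fin n) (Fin n) ℤ →+* End ℂ (Fin n → ℂ) :=
  (Matrix.toLinAlgEquiv' (R := ℂ) (n := Fin n)).toRingEquiv.toRingHom.comp
    (Int.castRingHom ℂ).mapMatrix

theorem intMatrixToEnd_injective (n : ℕ) : Function.Injective (intMatrixToEnd n) := by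
  intro A B h
  have h1 := (Matrix.toLinAlgEquiv' (R := ℂ) (n := Fin n)).injective h
  ext i j
  have := congrFun (congrFun h1 i) j
  simpa using this

theorem abs_pow_mul_sub_one_pow_le {Y : Matrix (Fin n) (Fin n) ℤ} {K : ℤ}
    (hK : ∀ k i j, |(Y ^ k) i j| ≤ K) (k : ℕ) :
    ∀ m i j, |(Y ^ m * (Y - 1) ^ k : Matrix (Fin n) (Fin n) ℤ) i j| ≤ 2 ^ k * K := by
  induction k with
  | zero => simpa using hK
  | succ k ih =>
    intro m i j
    have h : Y ^ m * (Y - 1) ^ (k + 1) = Y ^ (m + 1) * (Y - 1) ^ k - Y ^ m * (Y - 1) ^ k := by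
      rw [pow_succ' (Y - 1), pow_succ Y m, ← mul_assoc, mul_sub, mul_one, sub_mul]
    rw [h, Matrix.sub_apply]
    calc _ ≤ _ := abs_sub _ _
      _ ≤ 2 ^ k * K + 2 ^ k * K := add_le_add (ih _ i j) (ih _ i j)
      _ = _ := by ring

theorem exists_abs_pow_le {Y : Matrix (Fin n) (Fin n) ℤ} {a b : ℕ} (hb : 0 < b)
    (h : Y ^ (a + b) = Y ^ a) : ∃ K : ℤ, ∀ k i j, |(Y ^ k) i j| ≤ K := by
  refine ⟨∑ k ∈ Finset.range (a + b), ∑ i, ∑ j, |(Y ^ k) i j|, ?_⟩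
  intro k
  induction k using Nat.strong_induction_on with
  | _ k ih =>
    by_cases hk : k < a + b
    · intro i j
      calc |(Y ^ k) i j| ≤ ∑ j, |(Y ^ k) i j| :=
            Finset.single_le_sum (f := fun j => |(Y ^ k) i j|)
              (fun _ _ => abs_nonneg _) (Finset.mem_univ j)
        _ ≤ ∑ i, ∑ j, |(Y ^ k) i j| :=
            Finset.single_le_sum (f := fun i => ∑ j, |(Y ^ k) i j|)
              (fun _ _ => Finset.sum_nonneg fun _ _ => abs_nonneg _) (Finset.mem_univ i)
        _ ≤ _ := Finset.single_le_sum (f := fun k => ∑ i, ∑ j, |(Y ^ k) i j|)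
              (fun _ _ => Finset.sum_nonneg fun _ _ => Finset.sum_nonneg fun _ _ => abs_nonneg _)
              (Finset.mem_range.2 hk)
    · have h2 : Y ^ k = Y ^ (k - b) := by
        have e1 : k = (k - b - a) + (a + b) := by omega
        have e2 : k - b = (k - b - a) + a := by omega
        rw [e2, pow_add, ← h, ← pow_add, ← e1]
      rw [h2]
      exact ih _ (by omega)

theorem exists_pow_eq_one_add {R : Type*} [Ring R] (y : R) (b : ℕ) :
    ∃ s, y ^ b = 1 + b * (y - 1) + (y - 1) ^ 2 * s := by
  induction b with
  | zero => exact ⟨0, by simp⟩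
  | succ b ih =>
    obtain ⟨s, hs⟩ := ih
    refine ⟨b + s * y, ?_⟩
    have hc : (y - 1) ^ 2 * (b : R) = b * (y - 1) ^ 2 := (Nat.cast_commute b _).eq.symm
    rw [pow_succ, hs, mul_add, hc]
    push_cast
    noncomm_ring

/-- A monoid version of Minkowski's lemma. `Y ^ k * (Y - 1) ^ k` is divisible by `3 ^ k`, while its
entries are `O(2 ^ k)` because the powers of `Y` are bounded; so it vanishes for large `k`. This is
where the modulus 3, rather than 2, is needed. -/
theorem pow_card_succ_eq_of_torsion {Y C : Matrix (Fin n) (Fin n) ℤ} {a b : ℕ} (hb : 0 < b)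
    (h : Y ^ (a + b) = Y ^ a) (hC : Y * Y - Y = 3 • C) : Y ^ (n + 1) = Y ^ n := by
  obtain ⟨K, hK⟩ := exists_abs_pow_le hb h
  have hcomm : Commute Y (Y - 1) := (Commute.refl Y).sub_right (Commute.one_right Y)
  have hC' : Y * (Y - 1) = 3 • C := by rw [mul_sub, mul_one, hC]
  obtain ⟨k, hk⟩ : ∃ k : ℕ, (2 : ℤ) ^ k * K < 3 ^ k := by
    obtain ⟨k, hk⟩ := pow_unbounded_of_one_lt (K : ℝ) (show (1 : ℝ) < 3 / 2 by norm_num)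
    refine ⟨k, ?_⟩
    rw [div_pow, lt_div_iff₀ (by positivity)] at hk
    have : (2 : ℝ) ^ k * K < 3 ^ k := by linarith
    exact_mod_cast this
  have hnil : Y ^ k * (Y - 1) ^ k = 0 := by
    have h3 : Y ^ k * (Y - 1) ^ k = 3 ^ k • C ^ k := by
      rw [← hcomm.mul_pow, hC', smul_pow]
    have hC0 : C ^ k = 0 := by
      ext i j
      have h4 := abs_pow_mul_sub_one_pow_le hK k k i j
      rw [h3, Matrix.smul_apply, nsmul_eq_mul, abs_mul] at h4
      push_cast at h4
      rw [abs_of_nonneg (by positivity)] at h4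
      have h5 : (3 : ℤ) ^ k * |(C ^ k) i j| < 3 ^ k * 1 := by linarith
      have h6 := lt_of_mul_lt_mul_left h5 (by positivity)
      simpa using Int.abs_lt_one_iff.1 h6
    rw [h3, hC0, smul_zero]
  obtain ⟨m, hm1, hm2⟩ : ∃ m, Y ^ m * (Y - 1) ^ (k + 1) = 0 ∧ Y ^ (m + b) = Y ^ m := by
    refine ⟨a + k, ?_, ?_⟩
    · rw [pow_succ (Y - 1), pow_add, mul_assoc, ← mul_assoc (Y ^ k), hnil, zero_mul, mul_zero]
    · rw [show a + k + b = k + (a + b) by ring, pow_add, h, ← pow_add, add_comm]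
  -- Lowers the exponent of `Y - 1` down to 1: expanding `Y ^ b` to first order around 1,
  -- periodicity leaves `b` times the next lower term equal to zero.
  have hdesc : ∀ i, i ≤ k → Y ^ m * (Y - 1) ^ (k - i + 1) = 0 := by
    intro i
    induction i with
    | zero => intro _; simpa using hm1
    | succ i ih =>
      intro hi
      have ih' := ih (by omega)
      obtain ⟨j, hj⟩ : ∃ j, k - (i + 1) = j := ⟨_, rfl⟩
      rw [show k - i + 1 = j + 2 by omega] at ih'
      rw [hj]
      obtain ⟨s, hs⟩ := exists_pow_eq_one_add Y b
      have e1 : Y ^ m * (Y - 1) ^ j * Y ^ b = Y ^ m * (Y - 1) ^ j := by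
        rw [mul_assoc, ((hcomm.symm.pow_left j).pow_right b).eq, ← mul_assoc, ← pow_add, hm2]
      rw [hs, mul_add, mul_add, mul_one, ← mul_assoc _ ((Y - 1) ^ 2), mul_assoc _ _ ((Y - 1) ^ 2),
        ← pow_add, ih', zero_mul, add_zero, ← mul_assoc,
        ← (Nat.cast_commute b (Y ^ m * (Y - 1) ^ j)).eq, mul_assoc, mul_assoc, ← pow_succ] at e1
      have e2 : (b : Matrix (Fin n) (Fin n) ℤ) * (Y ^ m * (Y - 1) ^ (j + 1)) = 0 := by
        simpa using e1
      rw [← nsmul_eq_mul] at e2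
      ext p q
      have e3 := congrFun (congrFun e2 p) q
      rw [Matrix.smul_apply, nsmul_eq_mul, Matrix.zero_apply] at e3
      exact (mul_eq_zero.1 e3).resolve_left (by exact_mod_cast hb.ne')
  have hfin : Y ^ m * (Y - 1) = 0 := by simpa using hdesc k le_rfl
  -- Kernels of powers stabilize by exponent `n`, so `m` may be replaced by `n`.
  have hE : intMatrixToEnd n Y ^ n * (intMatrixToEnd n (Y - 1)) = 0 := by
    have h0 := congrArg (intMatrixToEnd n) hfin
    rw [map_mul, map_pow, map_zero] at h0
    have hker := Module.End.ker_pow_le_ker_pow_finrank (intMatrixToEnd n Y) m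
    rw [Module.finrank_fin_fun] at hker
    exact LinearMap.ext fun v => hker (LinearMap.congr_fun h0 v)
  rw [← map_pow, ← map_mul] at hE
  have := intMatrixToEnd_injective n (hE.trans (map_zero _).symm)
  rw [mul_sub, mul_one, ← pow_succ, sub_eq_zero] at this
  exact this

theorem exists_pow_eq_pow {R : Type*} [Monoid R] [Finite R] (x : R) :
    ∃ k, 0 < k ∧ IsIdempotentElem (x ^ k) := by
  obtain ⟨i, j, hij, h⟩ := Finite.exists_ne_map_eq_of_infinite fun k : ℕ => x ^ k
  wlog hlt : i < j generalizing i j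
  · exact this j i hij.symm h.symm (by omega)
  obtain ⟨d, rfl⟩ := Nat.exists_eq_add_of_lt hlt
  have h1 : ∀ c r, x ^ (i + r + c * (d + 1)) = x ^ (i + r) := by
    intro c
    induction c with
    | zero => simp
    | succ c ih =>
      intro r
      rw [show i + r + (c + 1) * (d + 1) = (i + d + 1) + (r + c * (d + 1)) by ring, pow_add, ← h,
        ← pow_add, ← add_assoc, ih]
  -- The exponent is `(i + 1) * (d + 1)`: a multiple of the period `d + 1` that is beyond the
  -- preperiod `i`.
  refine ⟨i + (i * d + d + 1), by omega, ?_⟩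
  rw [IsIdempotentElem, ← pow_add]
  have := h1 (i + 1) (i * d + d + 1)
  rw [← this]
  congr 1
  ring

theorem exists_uniform_idempotent_pow (R : Type*) [Monoid R] [Finite R] :
    ∃ k, 0 < k ∧ ∀ x : R, IsIdempotentElem (x ^ k) := by
  have := Fintype.ofFinite R
  choose k hk hx using fun x : R => exists_pow_eq_pow x
  refine ⟨∏ x, k x, Finset.prod_pos fun x _ => hk x, fun x => ?_⟩
  obtain ⟨c, hc⟩ := Finset.dvd_prod_of_mem k (Finset.mem_univ x)
  rw [hc, pow_mul]
  exact (hx x).pow c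

/-- A finitely generated monoid of integer matrices is finite as soon as every member that is
idempotent modulo `3` has trivial period. -/
theorem finite_range_wordProd_int {α : Type} [Finite α] (g : α → Matrix (Fin n) (Fin n) ℤ)
    (h : ∀ w, (∀ i j, (3 : ℤ) ∣ (wordProd g w * wordProd g w - wordProd g w) i j) →
      wordProd g w ^ (n + 1) = wordProd g w ^ n) : (Set.range (wordProd g)).Finite := by
  obtain ⟨k, hk, hidem⟩ := exists_uniform_idempotent_pow (Matrix (Fin n) (Fin n) (ZMod 3))
  have hper : ∀ w, wordProd g w ^ (k * n + k) = wordProd g w ^ (k * n) := by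
    intro w
    obtain ⟨w', hw'⟩ := exists_wordProd_pow g w k
    have := h w' (by
      intro i j
      have h1 := hidem ((Int.castRingHom (ZMod 3)).mapMatrix (wordProd g w))
      rw [← map_pow, ← hw', IsIdempotentElem, ← map_mul, ← sub_eq_zero, ← map_sub] at h1
      have h2 := congrFun (congrFun h1 i) j
      rw [RingHom.mapMatrix_apply, Matrix.map_apply] at h2
      exact (ZMod.intCast_zmod_eq_zero_iff_dvd _ 3).1 (by simpa using h2))
    rw [hw', ← pow_mul, ← pow_mul] at this
    exact this
  have hfin := finite_range_wordProd (N := k * n) hk _ (Fin n → ℂ) rfl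
    (fun a => intMatrixToEnd n (g a)) (by
      intro w
      have h1 := map_wordProd (intMatrixToEnd n) g w
      rw [← h1, ← map_pow, ← map_pow, hper])
  refine Set.Finite.of_finite_image (f := intMatrixToEnd n) (hfin.subset ?_)
    (intMatrixToEnd_injective n).injOn
  rintro _ ⟨_, ⟨w, rfl⟩, rfl⟩
  exact ⟨w, (map_wordProd (intMatrixToEnd n) g w).symm⟩

end IntegerMatrices

/-! ### Zero-sum multisets of bounded integer vectors. -/

section ZeroSum

/-- One-dimensional Steinitz lemma: as the total is zero, there is always a next term that does not
push the partial sum further from zero on its side. -/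
theorem exists_bounded_ordering {α : Type*} (f : α → ℤ) (C : ℤ) :
    ∀ (m : ℕ) (S : Multiset α) (x : ℤ), S.card = m → |x| ≤ C → (∀ a ∈ S, |f a| ≤ C) →
      x + (S.map f).sum = 0 →
      ∃ l : List α, (l : Multiset α) = S ∧ ∀ k, |x + ((l.take k).map f).sum| ≤ C := by
  intro m
  induction m with
  | zero =>
    intro S x hS hx _ _
    refine ⟨[], ?_, by simpa using hx⟩
    rw [Multiset.card_eq_zero] at hS
    simp [hS]
  | succ m ih =>
    intro S x hS hx hf hsum
    obtain ⟨a, ha, hxa⟩ : ∃ a ∈ S, |x + f a| ≤ C := by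
      by_contra! hcon
      rw [abs_le] at hx
      have hne : S ≠ 0 := by rintro rfl; simp at hS
      rcases le_or_gt x 0 with h0 | h0
      · have hneg : ∀ a ∈ S, f a < 0 := by
          intro a ha
          by_contra! h
          have := abs_le.1 (hf a ha)
          exact absurd (hcon a ha) (not_lt.2 (abs_le.2 ⟨by linarith, by linarith⟩))
        have := Multiset.sum_lt_sum_of_nonempty (s := S) (f := f) (g := fun _ => 0) hne hneg
        simp at this
        linarith
      · have hpos : ∀ a ∈ S, 0 < f a := by
          intro a ha
          by_contra! h
          have := abs_le.1 (hf a ha)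
          exact absurd (hcon a ha) (not_lt.2 (abs_le.2 ⟨by linarith, by linarith⟩))
        have := Multiset.sum_lt_sum_of_nonempty (s := S) (g := f) (f := fun _ => 0) hne hpos
        simp at this
        linarith
    obtain ⟨S', rfl⟩ := Multiset.exists_cons_of_mem ha
    rw [Multiset.map_cons, Multiset.sum_cons] at hsum
    obtain ⟨l, hl, hk⟩ := ih S' (x + f a) (by simpa using hS) hxa
      (fun b hb => hf b (Multiset.mem_cons_of_mem hb)) (by linarith)
    refine ⟨a :: l, by rw [← hl]; rfl, ?_⟩
    rintro (_ | k)
    · simpa using hx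
    · simpa [add_assoc] using hk k

theorem exists_zero_sum_submultiset {α : Type*} (f : α → ℤ) (C : ℕ) (S : Multiset α)
    (hf : ∀ a ∈ S, |f a| ≤ C) (hsum : (S.map f).sum = 0) (hcard : 2 * C + 1 ≤ S.card) :
    ∃ T ≤ S, T ≠ 0 ∧ T.card ≤ 2 * C + 1 ∧ (T.map f).sum = 0 := by
  obtain ⟨l, rfl, hl⟩ := exists_bounded_ordering f C _ S 0 rfl (by simp) hf (by simpa using hsum)
  rw [Multiset.coe_card] at hcard
  -- The first `2 * C + 2` partial sums take at most `2 * C + 1` values; the block between two equal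
  -- ones sums to zero.
  obtain ⟨i, hi, j, hj, hij, heq⟩ := Finset.exists_ne_map_eq_of_card_lt_of_maps_to
    (s := Finset.range (2 * C + 2)) (t := Finset.Icc (-(C : ℤ)) C)
    (f := fun k => ((l.take k).map f).sum) (by rw [Int.card_Icc, Finset.card_range]; omega)
    (fun k _ => by simpa [abs_le] using hl k)
  wlog hlt : i < j generalizing i j
  · exact this j hj i hi hij.symm heq.symm (by omega)
  rw [Finset.mem_range] at hi hj
  have htake : l.take j = l.take i ++ (l.drop i).take (j - i) := by
    conv_lhs => rw [show j = i + (j - i) by omega]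
    rw [List.take_add]
  refine ⟨((l.drop i).take (j - i) : List α), ?_, ?_, ?_, ?_⟩
  · exact Multiset.coe_le.2 ((List.take_sublist _ _).trans (List.drop_sublist _ _)).subperm
  · intro h
    have := congrArg Multiset.card h
    simp at this
    omega
  · simp; omega
  · have h : ((l.take i).map f).sum = ((l.take j).map f).sum := heq
    rw [htake, List.map_append, List.sum_append] at h
    rw [Multiset.map_coe, Multiset.sum_coe]
    linarith

theorem exists_zero_sum_partition {α : Type*} (f : α → ℤ) (C : ℕ) :
    ∀ (m : ℕ) (S : Multiset α), S.card = m → (∀ a ∈ S, |f a| ≤ C) → (S.map f).sum = 0 →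
      ∃ P : Multiset (Multiset α), P.join = S ∧
        ∀ T ∈ P, T.card ≤ 2 * C + 1 ∧ (T.map f).sum = 0 := by
  intro m
  induction m using Nat.strong_induction_on with
  | _ m ih =>
    intro S hm hf hsum
    by_cases hcard : S.card ≤ 2 * C + 1
    · exact ⟨{S}, by simp, by simpa using ⟨hcard, hsum⟩⟩
    · obtain ⟨T, hT, hT0, hTc, hTs⟩ := exists_zero_sum_submultiset f C S hf hsum (by omega)
      obtain ⟨S', rfl⟩ := Multiset.le_iff_exists_add.1 hT
      rw [Multiset.map_add, Multiset.sum_add, hTs, zero_add] at hsum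
      have hpos := Multiset.card_pos.2 hT0
      obtain ⟨P, hP, hPT⟩ := ih S'.card (by rw [← hm, Multiset.card_add]; omega) S' rfl
        (fun a ha => hf a (Multiset.mem_add.2 (Or.inr ha))) hsum
      refine ⟨T ::ₘ P, by simp [hP], ?_⟩
      intro T' hT'
      rcases Multiset.mem_cons.1 hT' with rfl | h
      · exact ⟨hTc, hTs⟩
      · exact hPT _ h

/-- A bound on the size of the minimal zero-sum multisets of vectors with entries at most `B`. -/
def zeroSumBound (B : ℕ) (d : ℕ) : ℕ :=
  Nat.rec 1 (fun _ K => K * (2 * (K * B) + 1)) d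

theorem card_join_le {α : Type*} (P : Multiset (Multiset α)) (K : ℕ)
    (h : ∀ T ∈ P, T.card ≤ K) : P.join.card ≤ P.card * K := by
  induction P using Multiset.induction_on with
  | empty => simp
  | cons T P ih =>
    have h1 := ih fun T' hT' => h T' (Multiset.mem_cons_of_mem hT')
    have h2 := h T (Multiset.mem_cons_self _ _)
    rw [Multiset.join_cons, Multiset.card_add, Multiset.card_cons]
    linarith

theorem sum_map_join {α : Type*} (P : Multiset (Multiset α)) (f : α → ℤ) :
    (P.join.map f).sum = (P.map fun T => (T.map f).sum).sum := by
  induction P using Multiset.induction_on with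
  | empty => simp
  | cons T P ih => simp

theorem abs_sum_map_le {α : Type*} (T : Multiset α) (f : α → ℤ) (B : ℕ)
    (h : ∀ a ∈ T, |f a| ≤ B) : |(T.map f).sum| ≤ T.card * B := by
  induction T using Multiset.induction_on with
  | empty => simp
  | cons a T ih =>
    have h1 := ih fun b hb => h b (Multiset.mem_cons_of_mem hb)
    have h2 := h a (Multiset.mem_cons_self _ _)
    rw [Multiset.map_cons, Multiset.sum_cons, Multiset.card_cons]
    refine (abs_add_le _ _).trans ?_
    push_cast
    linarith

/-- One coordinate at a time: parts of size at most `K` have coordinate sums at most `K * B`, so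
grouping at most `2 * (K * B) + 1` of them annihilates the next coordinate and preserves the earlier
ones. -/
theorem exists_vector_zero_sum_partition {d : ℕ} (B : ℕ) (S : Multiset (Fin d → ℤ))
    (hB : ∀ a ∈ S, ∀ i, |a i| ≤ B) (hsum : ∀ i, (S.map fun a => a i).sum = 0) :
    ∀ j, j ≤ d → ∃ P : Multiset (Multiset (Fin d → ℤ)), P.join = S ∧
        ∀ T ∈ P, T.card ≤ zeroSumBound B j ∧
          ∀ i : Fin d, (i : ℕ) < j → (T.map fun a => a i).sum = 0 := by
  intro j
  induction j with
  | zero =>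
    intro _
    refine ⟨S.map fun a => {a}, ?_, ?_⟩
    · simp [Multiset.join]
    · intro T hT
      obtain ⟨a, -, rfl⟩ := Multiset.mem_map.1 hT
      exact ⟨by simp [zeroSumBound], by simp⟩
  | succ j ih =>
    intro hj
    obtain ⟨P, rfl, hP⟩ := ih (by omega)
    let i₀ : Fin d := ⟨j, hj⟩
    obtain ⟨Q, rfl, hQ⟩ := exists_zero_sum_partition (fun T => (T.map fun a => a i₀).sum)
      (zeroSumBound B j * B) _ P rfl (by
        intro T hT
        refine (abs_sum_map_le T _ B fun a ha => hB a ?_ i₀).trans ?_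
        · exact Multiset.mem_join.2 ⟨T, hT, ha⟩
        · push_cast
          exact mul_le_mul_of_nonneg_right (by exact_mod_cast (hP T hT).1) (by positivity)) (by
        rw [← sum_map_join]; exact hsum i₀)
    refine ⟨Q.map Multiset.join, ?_, ?_⟩
    · clear hQ hP hsum hB ih
      induction Q using Multiset.induction_on with
      | empty => simp
      | cons T Q ihQ => simp [ihQ]
    · intro T hT
      obtain ⟨R, hR, rfl⟩ := Multiset.mem_map.1 hT
      have hRP : ∀ T ∈ R, T ∈ Q.join := fun T hT => Multiset.mem_join.2 ⟨R, hR, hT⟩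
      refine ⟨?_, ?_⟩
      · refine (card_join_le R _ fun T hT => (hP T (hRP T hT)).1).trans ?_
        rw [mul_comm]
        exact Nat.mul_le_mul_left _ (hQ R hR).1
      · intro i hi
        rw [sum_map_join]
        rcases Nat.lt_succ_iff_lt_or_eq.1 hi with h | h
        · refine Multiset.sum_eq_zero fun x hx => ?_
          obtain ⟨T, hT, rfl⟩ := Multiset.mem_map.1 hx
          exact (hP T (hRP T hT)).2 i h
        · have : i = i₀ := Fin.ext h
          rw [this]
          exact (hQ R hR).2

/-- Adjoin `-b` to get a zero-sum multiset, partition it, and keep the part containing `-b`; the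
others sum to zero and are discarded. -/
theorem exists_small_submultiset {d : ℕ} (B : ℕ) (b : Fin d → ℤ) (S : Multiset (Fin d → ℤ))
    (hb : ∀ i, |b i| ≤ B) (hB : ∀ a ∈ S, ∀ i, |a i| ≤ B) (hsum : S.sum = b) :
    ∃ T ≤ S, T.sum = b ∧ T.card ≤ zeroSumBound B d := by
  have happ : ∀ (T : Multiset (Fin d → ℤ)) i, (T.map fun a => a i).sum = T.sum i := by
    intro T i
    exact (map_multiset_sum (Pi.evalAddMonoidHom (fun _ : Fin d => ℤ) i) T).symm
  obtain ⟨P, hP, hT⟩ := exists_vector_zero_sum_partition B ((-b) ::ₘ S) (by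
    intro a ha i
    rcases Multiset.mem_cons.1 ha with rfl | h
    · simpa using hb i
    · exact hB a h i) (by
    intro i
    rw [happ, Multiset.sum_cons, hsum, neg_add_cancel]; rfl) d le_rfl
  obtain ⟨T, hTP, hbT⟩ := Multiset.mem_join.1 (hP ▸ Multiset.mem_cons_self (-b) S)
  obtain ⟨T', rfl⟩ := Multiset.exists_cons_of_mem hbT
  obtain ⟨hc, hz⟩ := hT _ hTP
  refine ⟨T', ?_, ?_, ?_⟩
  · obtain ⟨P', rfl⟩ := Multiset.exists_cons_of_mem hTP
    rw [Multiset.join_cons] at hP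
    have : (-b) ::ₘ T' ≤ (-b) ::ₘ S := hP ▸ Multiset.le_add_right _ _
    exact (Multiset.cons_le_cons_iff _).1 this
  · ext i
    have := hz i i.2
    rw [happ, Multiset.sum_cons, Pi.add_apply, Pi.neg_apply] at this
    linarith
  · rw [Multiset.card_cons] at hc
    omega

end ZeroSum

/-! ### Short walks of prescribed weight. -/

section Walks

variable {N : Type} {d : ℕ}

/-- Walks in a graph with edges labelled by vectors: the list of the sources of the edges, the
first and the last node, and the sum of the labels. -/
inductive Walk (E : N → (Fin d → ℤ) → N → Prop) : List N → N → N → (Fin d → ℤ) → Prop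
  | nil (s : N) : Walk E [] s s 0
  | cons {s a s' l t w} : E s a s' → Walk E l s' t w → Walk E (s :: l) s t (a + w)

variable {E : N → (Fin d → ℤ) → N → Prop}

theorem Walk.append {l s t w l' t' w'} (h : Walk E l s t w) (h' : Walk E l' t t' w') :
    Walk E (l ++ l') s t' (w + w') := by
  induction h with
  | nil s => simpa using h'
  | cons hE _ ih => rw [add_assoc]; exact Walk.cons hE (ih h')

theorem Walk.split_of_mem {l s t w} (h : Walk E l s t w) {x} (hx : x ∈ l) :
    ∃ l₁ l₂ w₁ w₂, l = l₁ ++ x :: l₂ ∧ Walk E l₁ s x w₁ ∧ Walk E (x :: l₂) x t w₂ ∧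
      w = w₁ + w₂ := by
  induction h with
  | nil s => simp at hx
  | @cons s a s' l t w hE hW ih =>
    rcases List.mem_cons.1 hx with rfl | hx
    · exact ⟨[], _, 0, _, rfl, .nil _, .cons hE hW, by simp⟩
    · obtain ⟨l₁, l₂, w₁, w₂, rfl, h1, h2, rfl⟩ := ih hx
      exact ⟨_, l₂, _, w₂, rfl, .cons hE h1, h2, (add_assoc _ _ _).symm⟩

theorem Walk.split {l s t w} (h : Walk E l s t w) {x} (hx : x ∈ l ++ [t]) :
    ∃ l₁ l₂ w₁ w₂, l = l₁ ++ l₂ ∧ Walk E l₁ s x w₁ ∧ Walk E l₂ x t w₂ ∧ w = w₁ + w₂ := by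
  rcases List.mem_append.1 hx with hx | hx
  · obtain ⟨l₁, l₂, w₁, w₂, r⟩ := h.split_of_mem hx
    exact ⟨l₁, x :: l₂, w₁, w₂, r⟩
  · obtain rfl : x = t := by simpa using hx
    exact ⟨l, [], w, 0, by simp, h, .nil _, by simp⟩

theorem Walk.insert_cycle {l s t w} (h : Walk E l s t w) {v lc c} (hv : v ∈ l ++ [t])
    (hc : Walk E lc v v c) :
    ∃ l', l'.length = l.length + lc.length ∧ (∀ x ∈ l ++ [t], x ∈ l' ++ [t]) ∧
      Walk E l' s t (w + c) := by
  obtain ⟨l₁, l₂, w₁, w₂, rfl, h1, h2, rfl⟩ := h.split hv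
  refine ⟨l₁ ++ (lc ++ l₂), by simp; omega, ?_, ?_⟩
  · intro x hx
    simp only [List.mem_append] at hx ⊢
    tauto
  · have := h1.append (hc.append h2)
    rwa [show w₁ + w₂ + c = w₁ + (c + w₂) by abel]

theorem Walk.insert_cycles {m : ℕ} (C : Multiset (Fin d → ℤ)) :
    ∀ {l s t w}, Walk E l s t w →
      (∀ c ∈ C, ∃ v ∈ l ++ [t], ∃ lc, lc.length ≤ m ∧ Walk E lc v v c) →
      ∃ l', l'.length ≤ l.length + C.card * m ∧ Walk E l' s t (w + C.sum) := by
  induction C using Multiset.induction_on with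
  | empty => intro l s t w h _; exact ⟨l, by simp, by simpa using h⟩
  | cons c C ih =>
    intro l s t w h hC
    obtain ⟨v, hv, lc, hlc, hc⟩ := hC c (Multiset.mem_cons_self _ _)
    obtain ⟨l₁, hl₁, hsub, h₁⟩ := h.insert_cycle hv hc
    obtain ⟨l₂, hl₂, h₂⟩ := ih h₁ (by
      intro c' hc'
      obtain ⟨v, hv, r⟩ := hC c' (Multiset.mem_cons_of_mem hc')
      exact ⟨v, hsub v hv, r⟩)
    refine ⟨l₂, ?_, ?_⟩
    · rw [Multiset.card_cons, add_mul]; omega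
    · rwa [Multiset.sum_cons, ← add_assoc]

theorem Walk.abs_le {B : ℕ} (hB : ∀ s a t, E s a t → ∀ i, |a i| ≤ B) {l s t w}
    (h : Walk E l s t w) (i : Fin d) : |w i| ≤ l.length * B := by
  induction h with
  | nil s => simp
  | cons hE _ ih =>
    have := hB _ _ _ hE i
    rw [Pi.add_apply, List.length_cons]
    refine (abs_add_le _ _).trans ?_
    push_cast
    linarith

open Classical in
/-- A walk decomposes into a short walk through the same nodes and short cycles. -/
theorem Walk.decompose [Fintype N] {l s t w} (h : Walk E l s t w) :
    ∃ (l₁ : List N) (r : N) (l₂ : List N) (w₁ w₂ : Fin d → ℤ) (C : Multiset (Fin d → ℤ)),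
      Walk E l₁ s r w₁ ∧ Walk E l₂ r t w₂ ∧ w = w₁ + w₂ + C.sum ∧ l₁.Nodup ∧
      (∀ x ∈ l₁, x ∈ l₂ ++ [t]) ∧
      l₂.length ≤ (Fintype.card N + 1) * (l₂ ++ [t]).toFinset.card ∧
      ∀ c ∈ C, ∃ v ∈ l₂ ++ [t], ∃ lc, lc.length ≤ Fintype.card N ∧ Walk E lc v v c := by
  induction h with
  | nil s => exact ⟨[], s, [], 0, 0, 0, .nil _, .nil _, by simp, by simp, by simp, by simp, by simp⟩
  | @cons s a s' l t w hE hW ih =>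
    obtain ⟨l₁, r, l₂, w₁, w₂, C, h1, h2, rfl, hnd, hsub, hlen, hC⟩ := ih
    -- `l₁` is a simple path whose nodes recur in `l₂`, so cutting a cycle from it loses no visited
    -- node. A source already in `l₁` closes such a cycle, one only in `l₂ ++ [t]` extends `l₁`, and
    -- a new one moves all of `l₁` into `l₂`, adding at most `card N + 1` edges per new node.
    by_cases hs1 : s ∈ l₁
    · obtain ⟨la, lb, wa, wb, rfl, ha, hb, rfl⟩ := h1.split_of_mem hs1
      refine ⟨s :: lb, r, l₂, wb, w₂, (a + wa) ::ₘ C, hb, h2, ?_, hnd.of_append_right,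
        fun x hx => hsub x (List.mem_append_right _ hx), hlen, ?_⟩
      · rw [Multiset.sum_cons]; abel
      · intro c hc
        rcases Multiset.mem_cons.1 hc with rfl | hc
        · refine ⟨s, hsub s hs1, s :: la, ?_, .cons hE ha⟩
          exact (List.nodup_middle.1 hnd).of_append_left.length_le_card
        · exact hC c hc
    · by_cases hs2 : s ∈ l₂ ++ [t]
      · refine ⟨s :: l₁, r, l₂, a + w₁, w₂, C, .cons hE h1, h2, by abel,
          List.nodup_cons.2 ⟨hs1, hnd⟩, ?_, hlen, hC⟩
        intro x hx
        rcases List.mem_cons.1 hx with rfl | hx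
        · exact hs2
        · exact hsub x hx
      · refine ⟨[], s, s :: l₁ ++ l₂, 0, a + w₁ + w₂, C, .nil _, ?_, by abel, List.nodup_nil,
          by simp, ?_, ?_⟩
        · rw [add_assoc]; exact .cons hE (h1.append h2)
        · have h3 : insert s (l₂ ++ [t]).toFinset ⊆ (s :: l₁ ++ l₂ ++ [t]).toFinset := by
            intro x hx
            simp only [Finset.mem_insert, List.mem_toFinset, List.mem_append, List.mem_cons] at hx ⊢
            tauto
          have h4 := Finset.card_le_card h3
          rw [Finset.card_insert_of_notMem (by simpa [and_comm] using hs2)] at h4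
          have h5 := Nat.mul_le_mul_left (Fintype.card N + 1) h4
          have h6 := hnd.length_le_card
          rw [mul_add] at h5
          refine le_trans ?_ h5
          simp only [List.cons_append, List.length_cons, List.length_append]
          omega
        · intro c hc
          obtain ⟨v, hv, x⟩ := hC c hc
          refine ⟨v, ?_, x⟩
          simp only [List.mem_append, List.mem_cons] at hv ⊢
          tauto

/-- A bound on the length of a shortest walk of given weight, in a graph with at most `m` nodes,
in dimension `d`, with all the weights bounded by `B`. -/
def walkBound (m d B : ℕ) : ℕ :=
  (m + 1) * (m + 1) + zeroSumBound (((m + 1) * (m + 1) + 1) * B) d * m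

/-- The skeleton has at most `(m + 1) * (m + 1)` edges, so the cycles have bounded total weight. A
small submultiset with the same sum suffices, and its cycles can be inserted because the skeleton
still visits their base points. -/
theorem Walk.exists_short [Finite N] {m B : ℕ} (hm : Nat.card N ≤ m)
    (hB : ∀ s a t, E s a t → ∀ i, |a i| ≤ B) {l s t w} (h : Walk E l s t w)
    (hw : ∀ i, |w i| ≤ B) : ∃ l', l'.length ≤ walkBound m d B ∧ Walk E l' s t w := by
  classical
  have := Fintype.ofFinite N
  rw [Nat.card_eq_fintype_card] at hm
  obtain ⟨l₁, r, l₂, w₁, w₂, C, h1, h2, rfl, hnd, hsub, hlen, hC⟩ := h.decompose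
  have hl1 := hnd.length_le_card
  have hl2 : l₂.length ≤ (m + 1) * m :=
    hlen.trans (Nat.mul_le_mul (by omega) ((Finset.card_le_univ _).trans hm))
  have h12 := h1.append h2
  have hL : (l₁ ++ l₂).length ≤ (m + 1) * (m + 1) := by
    rw [List.length_append, Nat.mul_add (m + 1)]; omega
  have hw12 := h12.abs_le hB
  have hL' : (((l₁ ++ l₂).length : ℕ) : ℤ) * B ≤ ((m + 1) * (m + 1) : ℕ) * B :=
    mul_le_mul_of_nonneg_right (by exact_mod_cast hL) (by positivity)
  obtain ⟨T, hT, hTs, hTc⟩ := exists_small_submultiset (((m + 1) * (m + 1) + 1) * B) C.sum C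
    (by
      intro i
      have e1 := hw i
      have e2 := (hw12 i).trans hL'
      rw [Pi.add_apply] at e1
      have e3 : C.sum i = (w₁ + w₂) i + C.sum i - (w₁ + w₂) i := by ring
      rw [e3]
      refine (abs_sub _ _).trans ?_
      push_cast at e2 ⊢
      linarith)
    (by
      intro c hc i
      obtain ⟨v, -, lc, hlc, hcyc⟩ := hC c hc
      refine (hcyc.abs_le hB i).trans ?_
      have : lc.length * B ≤ ((m + 1) * (m + 1) + 1) * B := by
        refine Nat.mul_le_mul_right B ?_
        have : m ≤ (m + 1) * (m + 1) := by nlinarith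
        omega
      exact_mod_cast this) rfl
  obtain ⟨l', hl', hW⟩ := Walk.insert_cycles (m := m) T h12 (by
    intro c hc
    obtain ⟨v, hv, lc, hlc, hcyc⟩ := hC c (Multiset.mem_of_le hT hc)
    exact ⟨v, by rw [List.append_assoc]; exact List.mem_append_right _ hv, lc, hlc.trans hm, hcyc⟩)
  refine ⟨l', ?_, hTs ▸ hW⟩
  have := Nat.mul_le_mul_right m hTc
  unfold walkBound
  omega

end Walks

/-! ### Integer arithmetic is primitive recursive. -/

section IntPrimrec

theorem encode_int_natCast (k : ℕ) : Encodable.encode (k : ℤ) = 2 * k := rfl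

theorem encode_int_negSucc (k : ℕ) : Encodable.encode (Int.negSucc k) = 2 * k + 1 := rfl

/-- Nonnegative integers have even codes and negative ones odd codes, so positive and negative parts
can be read off the code; the ring operations then reduce to natural numbers. -/
theorem primrec_int_toNat : Primrec Int.toNat := by
  have h : Primrec fun z : ℤ => if Encodable.encode z % 2 = 0 then Encodable.encode z / 2 else 0 :=
    Primrec.ite (Primrec.eq.comp (Primrec.nat_mod.comp Primrec.encode (Primrec.const 2))
      (Primrec.const 0)) (Primrec.nat_div.comp Primrec.encode (Primrec.const 2)) (Primrec.const 0)
  refine h.of_eq ?_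
  rintro (k | k)
  · rw [Int.ofNat_eq_natCast, encode_int_natCast]; simp
  · rw [encode_int_negSucc]
    simp [Nat.add_mod]

theorem primrec_int_neg_toNat : Primrec fun z : ℤ => (-z).toNat := by
  have h : Primrec fun z : ℤ =>
      if Encodable.encode z % 2 = 0 then 0 else Encodable.encode z / 2 + 1 :=
    Primrec.ite (Primrec.eq.comp (Primrec.nat_mod.comp Primrec.encode (Primrec.const 2))
      (Primrec.const 0)) (Primrec.const 0)
      (Primrec.succ.comp (Primrec.nat_div.comp Primrec.encode (Primrec.const 2)))
  refine h.of_eq ?_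
  rintro (k | k)
  · rw [Int.ofNat_eq_natCast, encode_int_natCast]; simp
  · rw [encode_int_negSucc]
    have h1 : (2 * k + 1) % 2 = 1 := by omega
    have h2 : (2 * k + 1) / 2 = k := by omega
    simp [h1, h2, Int.neg_negSucc]

theorem primrec_int_subNat : Primrec₂ fun a b : ℕ => (a : ℤ) - b := by
  have h : Primrec fun p : ℕ × ℕ => if p.2 ≤ p.1 then 2 * (p.1 - p.2) else 2 * (p.2 - p.1 - 1) + 1 :=
    Primrec.ite (Primrec.nat_le.comp Primrec.snd Primrec.fst)
      (Primrec.nat_double.comp (Primrec.nat_sub.comp Primrec.fst Primrec.snd))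
      (Primrec.nat_double_succ.comp (Primrec.nat_sub.comp
        (Primrec.nat_sub.comp Primrec.snd Primrec.fst) (Primrec.const 1)))
  refine Primrec.encode_iff.1 (h.of_eq ?_)
  rintro ⟨a, b⟩
  dsimp only
  split_ifs with hab
  · rw [← Nat.cast_sub hab, encode_int_natCast]
  · have : (a : ℤ) - b = Int.negSucc (b - a - 1) := by
      rw [Int.negSucc_eq]; omega
    rw [this, encode_int_negSucc]

theorem primrec_int_add : Primrec₂ fun x y : ℤ => x + y := by
  have hp := primrec_int_toNat
  have hn := primrec_int_neg_toNat
  have h : Primrec fun p : ℤ × ℤ =>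
      ((p.1.toNat + p.2.toNat : ℕ) : ℤ) - ((-p.1).toNat + (-p.2).toNat : ℕ) :=
    primrec_int_subNat.comp
      (Primrec.nat_add.comp (hp.comp Primrec.fst) (hp.comp Primrec.snd))
      (Primrec.nat_add.comp (hn.comp Primrec.fst) (hn.comp Primrec.snd))
  refine h.of_eq ?_
  rintro ⟨x, y⟩
  dsimp only
  omega

theorem primrec_int_neg : Primrec fun x : ℤ => -x := by
  have h : Primrec fun x : ℤ => (((-x).toNat : ℕ) : ℤ) - (x.toNat : ℕ) :=
    primrec_int_subNat.comp primrec_int_neg_toNat primrec_int_toNat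
  exact h.of_eq fun x => by omega

theorem primrec_int_mul : Primrec₂ fun x y : ℤ => x * y := by
  have hp := primrec_int_toNat
  have hn := primrec_int_neg_toNat
  have h : Primrec fun p : ℤ × ℤ =>
      ((p.1.toNat * p.2.toNat + (-p.1).toNat * (-p.2).toNat : ℕ) : ℤ) -
        (p.1.toNat * (-p.2).toNat + (-p.1).toNat * p.2.toNat : ℕ) :=
    primrec_int_subNat.comp
      (Primrec.nat_add.comp
        (Primrec.nat_mul.comp (hp.comp Primrec.fst) (hp.comp Primrec.snd))
        (Primrec.nat_mul.comp (hn.comp Primrec.fst) (hn.comp Primrec.snd)))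
      (Primrec.nat_add.comp
        (Primrec.nat_mul.comp (hp.comp Primrec.fst) (hn.comp Primrec.snd))
        (Primrec.nat_mul.comp (hn.comp Primrec.fst) (hp.comp Primrec.snd)))
  refine h.of_eq ?_
  rintro ⟨x, y⟩
  dsimp only
  have hx : (x.toNat : ℤ) - (-x).toNat = x := by omega
  have hy : (y.toNat : ℤ) - (-y).toNat = y := by omega
  conv_rhs => rw [← hx, ← hy]
  push_cast
  ring

theorem primrec_int_natAbs : Primrec Int.natAbs := by
  have h : Primrec fun x : ℤ => x.toNat + (-x).toNat :=
    Primrec.nat_add.comp primrec_int_toNat primrec_int_neg_toNat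
  exact h.of_eq fun x => by omega

end IntPrimrec

/-! ### Primitive recursion over lists. -/

section ListPrimrec

variable {α β σ : Type*} [Primcodable α] [Primcodable β] [Primcodable σ]

theorem Primrec.range_map {n : α → ℕ} {f : α → ℕ → σ} (hn : Primrec n) (hf : Primrec₂ f) :
    Primrec fun a => (List.range (n a)).map (f a) :=
  Primrec.list_map (Primrec.list_range.comp hn) hf

theorem Primrec.list_sum_int {f : α → List ℤ} (hf : Primrec f) : Primrec fun a => (f a).sum :=
  (Primrec.list_foldr (h := fun _ p => p.1 + p.2) hf (Primrec.const 0)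
    (primrec_int_add.comp (Primrec.fst.comp Primrec.snd) (Primrec.snd.comp Primrec.snd)).to₂).of_eq
    fun _ => rfl

theorem Primrec.list_sum_nat {f : α → List ℕ} (hf : Primrec f) : Primrec fun a => (f a).sum :=
  (Primrec.list_foldr (h := fun _ p => p.1 + p.2) hf (Primrec.const 0)
    (Primrec.nat_add.comp (Primrec.fst.comp Primrec.snd) (Primrec.snd.comp Primrec.snd)).to₂).of_eq
    fun _ => rfl

theorem PrimrecPred.forall_mem {L : α → List β} {R : α → β → Prop} (hL : Primrec L)
    (hR : PrimrecRel R) : PrimrecPred fun a => ∀ b ∈ L a, R a b :=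
  PrimrecRel.comp (R := fun (L : List β) a => ∀ b ∈ L, R a b)
    (PrimrecRel.forall_mem_list (R := fun b a => R a b) (hR.comp Primrec.snd Primrec.fst))
    hL Primrec.id

theorem PrimrecPred.exists_mem {L : α → List β} {R : α → β → Prop} (hL : Primrec L)
    (hR : PrimrecRel R) : PrimrecPred fun a => ∃ b ∈ L a, R a b :=
  PrimrecRel.comp (R := fun (L : List β) a => ∃ b ∈ L, R a b)
    (PrimrecRel.exists_mem_list (R := fun b a => R a b) (hR.comp Primrec.snd Primrec.fst))
    hL Primrec.id

theorem primrecPred_mem {L : α → List β} {b : α → β} (hL : Primrec L) (hb : Primrec b) :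
    PrimrecPred fun a => b a ∈ L a := by
  classical
  exact (PrimrecPred.exists_mem (R := fun a c => c = b a) hL
    (Primrec.eq.comp Primrec.snd (hb.comp Primrec.fst))).of_eq (by simp)

end ListPrimrec

/-! ### The algorithm on codes; missing entries default to zero, so it is total on malformed input.
-/

/-- The code of a transition: source, rows of the matrix, vector, target. -/
abbrev TransitionCode : Type := ℕ × List (List ℤ) × List ℤ × ℕ

/-- The entry at `(i, j)` of a list of rows. -/
def entry (A : List (List ℤ)) (i j : ℕ) : ℤ := (A.getD i []).getD j 0

/-- The list of rows of a square matrix. -/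
def rows (n : ℕ) (f : ℕ → ℕ → ℤ) : List (List ℤ) :=
  (List.range n).map fun i => (List.range n).map fun j => f i j

/-- Multiplication of matrices given as lists of rows. -/
def rowsMul (n : ℕ) (A B : List (List ℤ)) : List (List ℤ) :=
  rows n fun i j => ((List.range n).map fun k => entry A i k * entry B k j).sum

/-- The identity matrix as a list of rows. -/
def rowsOne (n : ℕ) : List (List ℤ) := rows n fun i j => if i = j then 1 else 0

/-- The powers of a matrix given as a list of rows. -/
def rowsPow (n : ℕ) (A : List (List ℤ)) (k : ℕ) : List (List ℤ) :=
  Nat.rec (rowsOne n) (fun _ P => rowsMul n P A) k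

/-- The product of a matrix and a vector given as lists. -/
def rowsMulVec (n : ℕ) (A : List (List ℤ)) (u : List ℤ) : List ℤ :=
  (List.range n).map fun i => ((List.range n).map fun k => entry A i k * u.getD k 0).sum

/-- The sum of vectors given as lists. -/
def vecAdd (n : ℕ) (u v : List ℤ) : List ℤ :=
  (List.range n).map fun i => u.getD i 0 + v.getD i 0

/-- The sum of the absolute values of the entries. -/
def vecNorm (u : List ℤ) : ℕ := (u.map Int.natAbs).sum

/-- Adds to a list of matrices their products with the matrices of the transitions. -/
def monoidStep (n : ℕ) (T : List TransitionCode) (L : List (List (List ℤ))) :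
    List (List (List ℤ)) :=
  L ++ L.flatMap fun A => T.map fun τ => rowsMul n A τ.2.1

/-- The products of at most `k` matrices of transitions. -/
def monoidLevel (n : ℕ) (T : List TransitionCode) (k : ℕ) : List (List (List ℤ)) :=
  (monoidStep n T)^[k] [rowsOne n]

/-- A matrix that is idempotent modulo `3` and has a nontrivial period. -/
def NonTorsion (n : ℕ) (A : List (List ℤ)) : Prop :=
  (∀ i ∈ List.range n, ∀ j ∈ List.range n,
    (entry (rowsMul n A A) i j + -entry A i j).natAbs % 3 = 0) ∧
    rowsPow n A (n + 1) ≠ rowsPow n A n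

/-- The products of at most `t` matrices form a monoid, or contain a matrix of infinite order. -/
def Saturated (n : ℕ) (T : List TransitionCode) (t : ℕ) : Prop :=
  (∀ A ∈ monoidLevel n T (t + 1), A ∈ monoidLevel n T t) ∨
    ∃ A ∈ monoidLevel n T t, NonTorsion n A

/-- The configuration after the transition `τ`, if the transition applies. -/
def configNext (n : ℕ) (c : ℕ × List ℤ) (τ : TransitionCode) : List (ℕ × List ℤ) :=
  if c.1 = τ.1 then [(τ.2.2.2, vecAdd n (rowsMulVec n τ.2.1 c.2) τ.2.2.1)] else []

/-- Adds to a list of configurations those reachable in one step. -/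
def configStep (n : ℕ) (T : List TransitionCode) (L : List (ℕ × List ℤ)) : List (ℕ × List ℤ) :=
  L ++ L.flatMap fun c => T.flatMap fun τ => configNext n c τ

/-- The configurations reachable in at most `k` steps. -/
def configLevel (n : ℕ) (T : List TransitionCode) (c : ℕ × List ℤ) (k : ℕ) : List (ℕ × List ℤ) :=
  (configStep n T)^[k] [c]

/-- A bound on the weights occurring in runs between given vectors. -/
def weightBound (n : ℕ) (T : List TransitionCode) (L : List (List (List ℤ))) (u v : List ℤ) : ℕ :=
  (L.map fun A => (T.map fun τ => vecNorm (rowsMulVec n A τ.2.2.1)).sum +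
    vecNorm (rowsMulVec n A u)).sum + vecNorm v

/-- The target is reachable within the number of steps allowed by the monoid level `t`. -/
def ShortReach (x : ReachCode) (t : ℕ) : Prop :=
  x.2.2.2.2 ∈ configLevel x.1 x.2.2.1 x.2.2.2.1
    (walkBound (x.2.1 * (monoidLevel x.1 x.2.2.1 t).length) x.1
      (weightBound x.1 x.2.2.1 (monoidLevel x.1 x.2.2.1 t) x.2.2.2.1.2 x.2.2.2.2.2))

/-! ### The ingredients of the algorithm are primitive recursive. -/

section AlgorithmPrimrec

variable {α : Type*} [Primcodable α]

open Primrec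

theorem primrec_entry {A : α → List (List ℤ)} {i j : α → ℕ} (hA : Primrec A) (hi : Primrec i)
    (hj : Primrec j) : Primrec fun a => entry (A a) (i a) (j a) :=
  (list_getD 0).comp ((list_getD []).comp hA hi) hj

theorem primrec_rows {n : α → ℕ} {f : α → ℕ → ℕ → ℤ} (hn : Primrec n)
    (hf : Primrec fun p : (α × ℕ) × ℕ => f p.1.1 p.1.2 p.2) : Primrec fun a => rows (n a) (f a) :=
  range_map hn (range_map (hn.comp fst) hf.to₂).to₂

theorem primrec_rowsMul {n : α → ℕ} {A B : α → List (List ℤ)} (hn : Primrec n) (hA : Primrec A)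
    (hB : Primrec B) : Primrec fun a => rowsMul (n a) (A a) (B a) := by
  refine primrec_rows hn (list_sum_int (range_map (hn.comp (fst.comp fst)) ?_))
  have h1 : Primrec fun p : ((α × ℕ) × ℕ) × ℕ => p.1.1.1 := fst.comp (fst.comp fst)
  exact primrec_int_mul.comp
    (primrec_entry (hA.comp h1) (snd.comp (fst.comp fst)) snd)
    (primrec_entry (hB.comp h1) snd (snd.comp fst))

theorem primrec_rowsOne {n : α → ℕ} (hn : Primrec n) : Primrec fun a => rowsOne (n a) :=
  primrec_rows hn (Primrec.ite (Primrec.eq.comp (snd.comp fst) snd) (const 1) (const 0))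

theorem primrec_rowsPow {n : α → ℕ} {A : α → List (List ℤ)} {k : α → ℕ} (hn : Primrec n)
    (hA : Primrec A) (hk : Primrec k) : Primrec fun a => rowsPow (n a) (A a) (k a) :=
  nat_rec' hk (primrec_rowsOne hn)
    (primrec_rowsMul (hn.comp fst) (snd.comp snd) (hA.comp fst)).to₂

theorem primrec_rowsMulVec {n : α → ℕ} {A : α → List (List ℤ)} {u : α → List ℤ} (hn : Primrec n)
    (hA : Primrec A) (hu : Primrec u) : Primrec fun a => rowsMulVec (n a) (A a) (u a) := by
  refine range_map (f := fun a i => ((List.range (n a)).map fun k =>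
    entry (A a) i k * (u a).getD k 0).sum) hn
    (list_sum_int (range_map (f := fun (p : α × ℕ) k => entry (A p.1) p.2 k * (u p.1).getD k 0)
      (hn.comp fst) ?_))
  have h1 : Primrec fun p : (α × ℕ) × ℕ => p.1.1 := fst.comp fst
  exact primrec_int_mul.comp (primrec_entry (hA.comp h1) (snd.comp fst) snd)
    ((list_getD 0).comp (hu.comp h1) snd)

theorem primrec_vecAdd {n : α → ℕ} {u v : α → List ℤ} (hn : Primrec n) (hu : Primrec u)
    (hv : Primrec v) : Primrec fun a => vecAdd (n a) (u a) (v a) :=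
  range_map hn (primrec_int_add.comp ((list_getD 0).comp (hu.comp fst) snd)
    ((list_getD 0).comp (hv.comp fst) snd)).to₂

theorem primrec_vecNorm {u : α → List ℤ} (hu : Primrec u) : Primrec fun a => vecNorm (u a) :=
  list_sum_nat (list_map hu (primrec_int_natAbs.comp snd).to₂)

theorem primrec_monoidStep {n : α → ℕ} {T : α → List TransitionCode}
    {L : α → List (List (List ℤ))} (hn : Primrec n) (hT : Primrec T) (hL : Primrec L) :
    Primrec fun a => monoidStep (n a) (T a) (L a) := by
  have hg : Primrec fun q : (α × List (List ℤ)) × TransitionCode =>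
      rowsMul (n q.1.1) q.1.2 q.2.2.1 :=
    primrec_rowsMul (hn.comp (fst.comp fst)) (snd.comp fst) (fst.comp (snd.comp snd))
  have hm : Primrec fun q : α × List (List ℤ) => (T q.1).map fun τ => rowsMul (n q.1) q.2 τ.2.1 :=
    list_map (hT.comp fst) hg.to₂
  exact list_append.comp hL (list_flatMap hL hm.to₂)

theorem primrec_monoidLevel {n : α → ℕ} {T : α → List TransitionCode} {k : α → ℕ} (hn : Primrec n)
    (hT : Primrec T) (hk : Primrec k) : Primrec fun a => monoidLevel (n a) (T a) (k a) :=
  nat_iterate hk (list_cons.comp (primrec_rowsOne hn) (const []))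
    (primrec_monoidStep (hn.comp fst) (hT.comp fst) snd).to₂

theorem primrecPred_nonTorsion {n : α → ℕ} {A : α → List (List ℤ)} (hn : Primrec n)
    (hA : Primrec A) : PrimrecPred fun a => NonTorsion (n a) (A a) := by
  refine PrimrecPred.and ?_ ?_
  · refine PrimrecPred.forall_mem (list_range.comp hn)
      (PrimrecPred.forall_mem (list_range.comp (hn.comp fst)) ?_)
    have h1 : Primrec fun p : (α × ℕ) × ℕ => p.1.1 := fst.comp fst
    have hn' := hn.comp h1
    have hA' := hA.comp h1
    exact Primrec.eq.comp (nat_mod.comp (primrec_int_natAbs.comp (primrec_int_add.comp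
      (primrec_entry (primrec_rowsMul hn' hA' hA') (snd.comp fst) snd)
      (primrec_int_neg.comp (primrec_entry hA' (snd.comp fst) snd)))) (const 3)) (const 0)
  · exact (Primrec.eq.comp (primrec_rowsPow hn hA (Primrec.succ.comp hn))
      (primrec_rowsPow hn hA hn)).not

theorem primrecPred_saturated {n : α → ℕ} {T : α → List TransitionCode} {k : α → ℕ}
    (hn : Primrec n) (hT : Primrec T) (hk : Primrec k) :
    PrimrecPred fun a => Saturated (n a) (T a) (k a) := by
  refine PrimrecPred.or ?_ ?_
  · refine PrimrecPred.forall_mem (primrec_monoidLevel hn hT (Primrec.succ.comp hk)) ?_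
    exact primrecPred_mem (primrec_monoidLevel (hn.comp fst) (hT.comp fst) (hk.comp fst)) snd
  · exact PrimrecPred.exists_mem (primrec_monoidLevel hn hT hk)
      (primrecPred_nonTorsion (hn.comp fst) snd)

theorem primrec_configNext {n : α → ℕ} {c : α → ℕ × List ℤ} {τ : α → TransitionCode}
    (hn : Primrec n) (hc : Primrec c) (hτ : Primrec τ) :
    Primrec fun a => configNext (n a) (c a) (τ a) := by
  have h2 := snd.comp hτ
  have hv := primrec_vecAdd hn (primrec_rowsMulVec hn (fst.comp h2) (snd.comp hc))
    (fst.comp (snd.comp h2))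
  exact Primrec.ite (Primrec.eq.comp (fst.comp hc) (fst.comp hτ))
    (list_cons.comp (Primrec.pair (snd.comp (snd.comp h2)) hv) (const [])) (const [])

theorem primrec_configStep {n : α → ℕ} {T : α → List TransitionCode}
    {L : α → List (ℕ × List ℤ)} (hn : Primrec n) (hT : Primrec T) (hL : Primrec L) :
    Primrec fun a => configStep (n a) (T a) (L a) := by
  have hg : Primrec fun q : (α × (ℕ × List ℤ)) × TransitionCode =>
      configNext (n q.1.1) q.1.2 q.2 :=
    primrec_configNext (hn.comp (fst.comp fst)) (snd.comp fst) snd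
  have hm : Primrec fun q : α × (ℕ × List ℤ) => (T q.1).flatMap fun τ => configNext (n q.1) q.2 τ :=
    list_flatMap (hT.comp fst) hg.to₂
  exact list_append.comp hL (list_flatMap hL hm.to₂)

theorem primrec_configLevel {n : α → ℕ} {T : α → List TransitionCode} {c : α → ℕ × List ℤ}
    {k : α → ℕ} (hn : Primrec n) (hT : Primrec T) (hc : Primrec c) (hk : Primrec k) :
    Primrec fun a => configLevel (n a) (T a) (c a) (k a) :=
  nat_iterate hk (list_cons.comp hc (const []))
    (primrec_configStep (hn.comp fst) (hT.comp fst) snd).to₂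

theorem primrec_weightBound {n : α → ℕ} {T : α → List TransitionCode}
    {L : α → List (List (List ℤ))} {u v : α → List ℤ} (hn : Primrec n) (hT : Primrec T)
    (hL : Primrec L) (hu : Primrec u) (hv : Primrec v) :
    Primrec fun a => weightBound (n a) (T a) (L a) (u a) (v a) := by
  have h1 : Primrec fun p : (α × List (List ℤ)) × TransitionCode =>
      vecNorm (rowsMulVec (n p.1.1) p.1.2 p.2.2.2.1) :=
    primrec_vecNorm (primrec_rowsMulVec (hn.comp (fst.comp fst)) (snd.comp fst)
      (fst.comp (snd.comp (snd.comp snd))))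
  have h2 : Primrec fun p : α × List (List ℤ) =>
      ((T p.1).map fun τ => vecNorm (rowsMulVec (n p.1) p.2 τ.2.2.1)).sum :=
    list_sum_nat (list_map (hT.comp fst) h1.to₂)
  have h3 : Primrec fun p : α × List (List ℤ) => vecNorm (rowsMulVec (n p.1) p.2 (u p.1)) :=
    primrec_vecNorm (primrec_rowsMulVec (hn.comp fst) snd (hu.comp fst))
  have h4 := list_sum_nat (list_map hL (nat_add.comp h2 h3).to₂)
  exact nat_add.comp h4 (primrec_vecNorm hv)

theorem primrec_zeroSumBound {B d : α → ℕ} (hB : Primrec B) (hd : Primrec d) :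
    Primrec fun a => zeroSumBound (B a) (d a) := by
  refine nat_rec' (h := fun a p => p.2 * (2 * (p.2 * B a) + 1)) hd (const 1) ?_
  have hK : Primrec fun p : α × ℕ × ℕ => p.2.2 := snd.comp snd
  exact (nat_mul.comp hK (Primrec.succ.comp (nat_mul.comp (const 2)
    (nat_mul.comp hK (hB.comp fst))))).to₂

theorem primrec_walkBound {m d B : α → ℕ} (hm : Primrec m) (hd : Primrec d) (hB : Primrec B) :
    Primrec fun a => walkBound (m a) (d a) (B a) := by
  have h1 := nat_mul.comp (Primrec.succ.comp hm) (Primrec.succ.comp hm)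
  exact nat_add.comp h1 (nat_mul.comp (primrec_zeroSumBound
    (nat_mul.comp (Primrec.succ.comp h1) hB) hd) hm)

theorem primrecRel_shortReach : PrimrecRel ShortReach := by
  have hn : Primrec fun p : ReachCode × ℕ => p.1.1 := fst.comp fst
  have hq : Primrec fun p : ReachCode × ℕ => p.1.2.1 := fst.comp (snd.comp fst)
  have hT : Primrec fun p : ReachCode × ℕ => p.1.2.2.1 := fst.comp (snd.comp (snd.comp fst))
  have hcc : Primrec fun p : ReachCode × ℕ => p.1.2.2.2 := snd.comp (snd.comp (snd.comp fst))
  have hc : Primrec fun p : ReachCode × ℕ => p.1.2.2.2.1 := fst.comp hcc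
  have hc' : Primrec fun p : ReachCode × ℕ => p.1.2.2.2.2 := snd.comp hcc
  have hL := primrec_monoidLevel hn hT snd
  have hB := primrec_weightBound hn hT hL (snd.comp hc) (snd.comp hc')
  have hW := primrec_walkBound (nat_mul.comp hq (list_length.comp hL)) hn hB
  have h := primrec_configLevel hn hT hc hW
  exact primrecPred_mem h hc'

end AlgorithmPrimrec

/-! ### Correctness of the list operations and termination of the search. -/

section Codes

variable {n : ℕ}

/-- The matrix with the given list of rows. -/
def toMat (n : ℕ) (A : List (List ℤ)) : Matrix (Fin n) (Fin n) ℤ := .of fun i j => entry A i j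

/-- The list of rows of a matrix. -/
def ofMat (M : Matrix (Fin n) (Fin n) ℤ) : List (List ℤ) :=
  List.ofFn fun i => List.ofFn fun j => M i j

theorem map_range_eq_ofFn {α : Type*} (n : ℕ) (f : ℕ → α) :
    (List.range n).map f = List.ofFn fun i : Fin n => f i :=
  List.ext_getElem (by simp) (by simp)

theorem sum_map_range (n : ℕ) (f : ℕ → ℤ) : ((List.range n).map f).sum = ∑ i : Fin n, f i := by
  rw [map_range_eq_ofFn, List.sum_ofFn]

theorem getD_ofFn {α : Type*} (f : Fin n → α) (d : α) (i : Fin n) :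
    (List.ofFn f).getD i d = f i := by simp

theorem entry_ofMat (M : Matrix (Fin n) (Fin n) ℤ) (i j : Fin n) : entry (ofMat M) i j = M i j := by
  rw [entry, ofMat, getD_ofFn, getD_ofFn]

@[simp] theorem toMat_ofMat (M : Matrix (Fin n) (Fin n) ℤ) : toMat n (ofMat M) = M := by
  ext i j
  exact entry_ofMat M i j

theorem ofMat_injective : Function.Injective (ofMat (n := n)) :=
  Function.LeftInverse.injective toMat_ofMat

theorem rows_eq_ofMat (f : ℕ → ℕ → ℤ) : rows n f = ofMat (.of fun i j : Fin n => f i j) := by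
  rw [rows, map_range_eq_ofFn, ofMat]
  congr 1
  ext1 i
  rw [map_range_eq_ofFn]
  rfl

theorem rowsMul_eq (A B : List (List ℤ)) : rowsMul n A B = ofMat (toMat n A * toMat n B) := by
  rw [rowsMul, rows_eq_ofMat]
  congr 1
  ext i j
  simp [sum_map_range, Matrix.mul_apply, toMat]

theorem rowsOne_eq : rowsOne n = ofMat (n := n) 1 := by
  rw [rowsOne, rows_eq_ofMat]
  congr 1
  ext i j
  simp [Matrix.one_apply, Fin.ext_iff]

theorem rowsPow_eq (M : Matrix (Fin n) (Fin n) ℤ) (k : ℕ) : rowsPow n (ofMat M) k = ofMat (M ^ k) := by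
  induction k with
  | zero => exact rowsOne_eq
  | succ k ih =>
    have h : rowsPow n (ofMat M) (k + 1) = rowsMul n (rowsPow n (ofMat M) k) (ofMat M) := rfl
    rw [h, ih, rowsMul_eq, toMat_ofMat, toMat_ofMat, pow_succ]

theorem rowsMulVec_eq (M : Matrix (Fin n) (Fin n) ℤ) (u : Fin n → ℤ) :
    rowsMulVec n (ofMat M) (List.ofFn u) = List.ofFn (Matrix.mulVec M u) := by
  rw [rowsMulVec, map_range_eq_ofFn]
  congr 1
  ext1 i
  rw [sum_map_range]
  simp only [entry_ofMat, getD_ofFn]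
  rfl

theorem vecAdd_eq (u v : Fin n → ℤ) : vecAdd n (List.ofFn u) (List.ofFn v) = List.ofFn (u + v) := by
  rw [vecAdd, map_range_eq_ofFn]
  simp only [getD_ofFn]
  rfl

theorem abs_le_vecNorm (u : Fin n → ℤ) (i : Fin n) : |u i| ≤ vecNorm (List.ofFn u) := by
  rw [Int.abs_eq_natAbs, vecNorm]
  exact_mod_cast List.single_le_sum (by simp) _ (List.mem_map.2 ⟨u i, by simp, rfl⟩)

theorem nonTorsion_ofMat_iff (M : Matrix (Fin n) (Fin n) ℤ) :
    NonTorsion n (ofMat M) ↔ (∀ i j, (3 : ℤ) ∣ (M * M - M) i j) ∧ M ^ (n + 1) ≠ M ^ n := by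
  rw [NonTorsion, rowsPow_eq, rowsPow_eq, ofMat_injective.ne_iff, rowsMul_eq, toMat_ofMat]
  refine and_congr_left fun _ => ⟨fun h i j => ?_, fun h i hi j hj => ?_⟩
  · have := h i (by simp) j (by simp)
    rw [entry_ofMat, entry_ofMat] at this
    rw [Matrix.sub_apply]
    omega
  · rw [List.mem_range] at hi hj
    have := h ⟨i, hi⟩ ⟨j, hj⟩
    have e1 := entry_ofMat (M * M) ⟨i, hi⟩ ⟨j, hj⟩
    have e2 := entry_ofMat M ⟨i, hi⟩ ⟨j, hj⟩
    dsimp only at e1 e2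
    rw [e1, e2]
    rw [Matrix.sub_apply] at this
    omega

theorem monoidLevel_succ (T : List TransitionCode) (k : ℕ) :
    monoidLevel n T (k + 1) = monoidStep n T (monoidLevel n T k) :=
  Function.iterate_succ_apply' _ _ _

theorem mem_monoidLevel_iff (T : List TransitionCode) (k : ℕ) (A : List (List ℤ)) :
    A ∈ monoidLevel n T k ↔ ∃ w : List {τ // τ ∈ T}, w.length ≤ k ∧
      ofMat (wordProd (fun τ => toMat n τ.1.2.1) w) = A := by
  induction k generalizing A with
  | zero =>
    simp only [monoidLevel, Function.iterate_zero, id, List.mem_singleton, Nat.le_zero,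
      List.length_eq_zero_iff]
    exact ⟨fun h => ⟨[], rfl, by rw [h, rowsOne_eq]; rfl⟩,
      fun ⟨w, hw, h⟩ => by rw [← h, hw, rowsOne_eq]; rfl⟩
  | succ k ih =>
    rw [monoidLevel_succ, monoidStep, List.mem_append]
    constructor
    · rintro (h | h)
      · obtain ⟨w, hw, h⟩ := (ih A).1 h
        exact ⟨w, by omega, h⟩
      · obtain ⟨B, hB, h⟩ := List.mem_flatMap.1 h
        obtain ⟨τ, hτ, rfl⟩ := List.mem_map.1 h
        obtain ⟨w, hw, rfl⟩ := (ih B).1 hB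
        exact ⟨w ++ [⟨τ, hτ⟩], by simpa using hw, by simp [rowsMul_eq]⟩
    · rintro ⟨w, hw, rfl⟩
      by_cases hk : w.length ≤ k
      · exact Or.inl ((ih _).2 ⟨w, hk, rfl⟩)
      · right
        have hne : w ≠ [] := by rintro rfl; simp at hk
        rw [List.mem_flatMap]
        refine ⟨_, (ih _).2 ⟨w.dropLast, by simp; omega, rfl⟩, List.mem_map.2
          ⟨(w.getLast hne).1, (w.getLast hne).2, ?_⟩⟩
        rw [rowsMul_eq, toMat_ofMat]
        conv_rhs => rw [← List.dropLast_append_getLast hne]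
        simp

/-- Holds for arbitrary lists, without finiteness of the monoid, as totality of the algorithm
requires: if no nontorsion witness ever appears, the products form a finite set. -/
theorem exists_saturated (n : ℕ) (T : List TransitionCode) : ∃ t, Saturated n T t := by
  by_contra! hcon
  have hfin : (Set.range (wordProd fun τ : {τ // τ ∈ T} => toMat n τ.1.2.1)).Finite := by
    refine finite_range_wordProd_int _ fun w h => ?_
    by_contra hne
    exact hcon w.length (Or.inr ⟨_, (mem_monoidLevel_iff T _ _).2 ⟨w, le_rfl, rfl⟩,
      (nonTorsion_ofMat_iff _).2 ⟨h, hne⟩⟩)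
  -- One word is fixed for each of the finitely many products; the maximal length of these words is
  -- a saturated level.
  choose! f hf using fun (M : Matrix (Fin n) (Fin n) ℤ)
    (hM : M ∈ Set.range (wordProd fun τ : {τ // τ ∈ T} => toMat n τ.1.2.1)) => hM
  obtain ⟨t, ht⟩ := (hfin.image fun M => (f M).length).bddAbove
  refine hcon t (Or.inl fun A hA => ?_)
  obtain ⟨w, -, rfl⟩ := (mem_monoidLevel_iff T _ _).1 hA
  have hw : wordProd (fun τ : {τ // τ ∈ T} => toMat n τ.1.2.1) w ∈
    Set.range (wordProd fun τ : {τ // τ ∈ T} => toMat n τ.1.2.1) := ⟨w, rfl⟩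
  exact (mem_monoidLevel_iff T _ _).2 ⟨_, ht ⟨_, hw, rfl⟩, by rw [hf _ hw]⟩

end Codes

/-! ### Runs as walks over states paired with matrices. -/

namespace AffineZVASS

variable {V : AffineZVASS} (P : V.Presentation)

theorem run_append {w w' : List (AffineTransition V.dim V.State)} {c c' c'' : V.Config}
    (h : V.Run w c c') (h' : V.Run w' c' c'') : V.Run (w ++ w') c c'' := by
  induction w generalizing c with
  | nil => obtain rfl : c = c' := h; exact h'
  | cons t w ih =>
    obtain ⟨c₁, h1, h2⟩ := h
    exact ⟨c₁, h1, ih h2⟩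

theorem run_append_iff {w w' : List (AffineTransition V.dim V.State)} {c c'' : V.Config} :
    V.Run (w ++ w') c c'' ↔ ∃ c', V.Run w c c' ∧ V.Run w' c' c'' := by
  refine ⟨fun h => ?_, fun ⟨c', h, h'⟩ => run_append h h'⟩
  induction w generalizing c with
  | nil => exact ⟨c, rfl, h⟩
  | cons t w ih =>
    obtain ⟨c₁, h1, h2⟩ := h
    obtain ⟨c', h3, h4⟩ := ih h2
    exact ⟨c', ⟨c₁, h1, h3⟩, h4⟩

theorem Presentation.codeConfig_injective : Function.Injective P.codeConfig := by
  rintro ⟨p, u⟩ ⟨q, v⟩ h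
  simp only [Presentation.codeConfig, Prod.mk.injEq, Fin.val_inj, List.ofFn_inj] at h
  exact Prod.ext (P.numbering.injective h.1) h.2

theorem Presentation.configNext_codeConfig (c : V.Config)
    (t : AffineTransition V.dim V.State) (y : ℕ × List ℤ) :
    y ∈ configNext V.dim (P.codeConfig c) (P.codeTransition t) ↔
      ∃ c', V.Step t c c' ∧ P.codeConfig c' = y := by
  have hstate : (P.codeConfig c).1 = (P.codeTransition t).1 ↔ c.1 = t.src := by
    simp [Presentation.codeConfig, Presentation.codeTransition, Fin.val_inj]
  have hvec : vecAdd V.dim (rowsMulVec V.dim (P.codeTransition t).2.1 (P.codeConfig c).2)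
      (P.codeTransition t).2.2.1 = List.ofFn (t.apply c.2) := by
    have h1 : rowsMulVec V.dim (P.codeTransition t).2.1 (P.codeConfig c).2 =
      List.ofFn (Matrix.mulVec t.mat c.2) := rowsMulVec_eq _ _
    rw [h1]
    exact vecAdd_eq _ _
  rw [configNext, hvec]
  split_ifs with h
  · rw [List.mem_singleton]
    constructor
    · rintro rfl
      exact ⟨(t.tgt, t.apply c.2), ⟨hstate.1 h, rfl, rfl⟩, rfl⟩
    · rintro ⟨⟨q, v⟩, ⟨-, h2, h3⟩, rfl⟩
      dsimp only at h2 h3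
      rw [h2, h3]
      rfl
  · simp only [List.not_mem_nil, false_iff, not_exists, not_and]
    intro c' hs
    exact absurd (hstate.2 hs.1) h

theorem Presentation.mem_configLevel_iff (c : V.Config) (k : ℕ) (y : ℕ × List ℤ) :
    y ∈ configLevel V.dim (P.list.map P.codeTransition) (P.codeConfig c) k ↔
      ∃ c' w, w.length ≤ k ∧ (∀ t ∈ w, t ∈ V.transitions) ∧ V.Run w c c' ∧
        P.codeConfig c' = y := by
  induction k generalizing y with
  | zero =>
    simp only [configLevel, Function.iterate_zero, id, List.mem_singleton, Nat.le_zero,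
      List.length_eq_zero_iff]
    constructor
    · rintro rfl
      exact ⟨c, [], rfl, by simp, rfl, rfl⟩
    · rintro ⟨c', w, rfl, -, h, rfl⟩
      obtain rfl : c = c' := h
      rfl
  | succ k ih =>
    have hs : configLevel V.dim (P.list.map P.codeTransition) (P.codeConfig c) (k + 1) =
      configStep V.dim (P.list.map P.codeTransition)
        (configLevel V.dim (P.list.map P.codeTransition) (P.codeConfig c) k) :=
      Function.iterate_succ_apply' _ _ _
    rw [hs, configStep, List.mem_append]
    constructor
    · rintro (h | h)
      · obtain ⟨c', w, hw, r⟩ := (ih y).1 h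
        exact ⟨c', w, by omega, r⟩
      · obtain ⟨z, hz, h⟩ := List.mem_flatMap.1 h
        obtain ⟨τ, hτ, h⟩ := List.mem_flatMap.1 h
        obtain ⟨t, ht, rfl⟩ := List.mem_map.1 hτ
        obtain ⟨c₁, w, hw, hwT, hrun, rfl⟩ := (ih z).1 hz
        obtain ⟨c', hstep, rfl⟩ := (P.configNext_codeConfig c₁ t y).1 h
        refine ⟨c', w ++ [t], by simpa using hw, ?_, run_append hrun ⟨c', hstep, rfl⟩, rfl⟩
        intro t' ht'
        rcases List.mem_append.1 ht' with h' | h'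
        · exact hwT t' h'
        · rw [List.mem_singleton.1 h']
          exact (P.mem_list t).1 ht
    · rintro ⟨c', w, hw, hwT, hrun, rfl⟩
      by_cases hk : w.length ≤ k
      · exact Or.inl ((ih _).2 ⟨c', w, hk, hwT, hrun, rfl⟩)
      · right
        have hne : w ≠ [] := by rintro rfl; simp at hk
        rw [← List.dropLast_append_getLast hne] at hrun
        obtain ⟨c₁, h1, c₂, h2, rfl⟩ := run_append_iff.1 hrun
        rw [List.mem_flatMap]
        refine ⟨_, (ih _).2 ⟨c₁, w.dropLast, by simp; omega,
          fun t ht => hwT t (List.mem_of_mem_dropLast ht), h1, rfl⟩, ?_⟩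
        rw [List.mem_flatMap]
        exact ⟨_, List.mem_map.2 ⟨_, (P.mem_list _).2 (hwT _ (List.getLast_mem hne)), rfl⟩,
          (P.configNext_codeConfig _ _ _).2 ⟨c₂, h2, rfl⟩⟩

/-- The edges between pairs of a control-state and a matrix: going through a transition backwards
multiplies the matrix by that of the transition. -/
def Edge (V : AffineZVASS) (S : Set (Matrix (Fin V.dim) (Fin V.dim) ℤ)) (x : V.State × S)
    (a : Fin V.dim → ℤ) (y : V.State × S) : Prop :=
  ∃ t ∈ V.transitions, x.1 = t.src ∧ y.1 = t.tgt ∧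
    (x.2 : Matrix (Fin V.dim) (Fin V.dim) ℤ) = y.2 * t.mat ∧ a = Matrix.mulVec y.2 t.vec

/-- Each translation vector contributes to the final value after multiplication by all later
matrices, which is the matrix stored at the target of its edge. The run becomes additive at the
price of guessing `A` at the start. -/
theorem exists_walk_of_run {S : Set (Matrix (Fin V.dim) (Fin V.dim) ℤ)}
    (hS : ∀ A ∈ S, ∀ t ∈ V.transitions, A * t.mat ∈ S) (h1 : 1 ∈ S)
    {w : List (AffineTransition V.dim V.State)} (hw : ∀ t ∈ w, t ∈ V.transitions) {c c' : V.Config}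
    (hrun : V.Run w c c') : ∃ (A : S) (l : _) (b : Fin V.dim → ℤ),
      Walk (V.Edge S) l (c.1, A) (c'.1, ⟨1, h1⟩) b ∧ c'.2 = Matrix.mulVec A.1 c.2 + b := by
  induction w generalizing c with
  | nil =>
    obtain rfl : c = c' := hrun
    exact ⟨⟨1, h1⟩, [], 0, .nil _, by simp⟩
  | cons t w ih =>
    obtain ⟨c₁, ⟨hsrc, htgt, hvec⟩, hrun⟩ := hrun
    obtain ⟨A, l, b, hW, hb⟩ := ih (fun t ht => hw t (List.mem_cons_of_mem _ ht)) hrun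
    have ht := hw t (List.mem_cons_self ..)
    refine ⟨⟨_, hS A.1 A.2 t ht⟩, _, _, .cons ⟨t, ht, hsrc, htgt, rfl, rfl⟩ hW, ?_⟩
    rw [hb, hvec, AffineTransition.apply, Matrix.mulVec_add, Matrix.mulVec_mulVec, add_assoc]

theorem exists_run_of_walk {S : Set (Matrix (Fin V.dim) (Fin V.dim) ℤ)} {l x y b}
    (hW : Walk (V.Edge S) l x y b) (hy : (y.2 : Matrix (Fin V.dim) (Fin V.dim) ℤ) = 1)
    (u : Fin V.dim → ℤ) : ∃ w : List (AffineTransition V.dim V.State), w.length = l.length ∧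
      (∀ t ∈ w, t ∈ V.transitions) ∧ V.Run w (x.1, u) (y.1, Matrix.mulVec x.2.1 u + b) := by
  induction hW generalizing u with
  | nil x => exact ⟨[], rfl, by simp, by simp [Run, hy]⟩
  | @cons x a x' l y b hE _ ih =>
    obtain ⟨t, ht, hsrc, htgt, hmat, rfl⟩ := hE
    obtain ⟨w, hl, hw, hrun⟩ := ih hy (t.apply u)
    refine ⟨t :: w, by simp [hl], by simpa using ⟨ht, hw⟩, (x'.1, t.apply u),
      ⟨hsrc, htgt, rfl⟩, ?_⟩
    convert hrun using 2
    rw [AffineTransition.apply, Matrix.mulVec_add, Matrix.mulVec_mulVec, hmat, add_assoc]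

theorem mem_monoid_of_wordProd {T : List TransitionCode} (hT : T = P.list.map P.codeTransition)
    (w : List {τ // τ ∈ T}) : wordProd (fun τ => toMat V.dim τ.1.2.1) w ∈ V.monoid := by
  induction w with
  | nil => exact one_mem _
  | cons τ w ih =>
    rw [wordProd_cons]
    refine mul_mem ?_ ih
    obtain ⟨τ, hτ⟩ := τ
    obtain ⟨t, ht, rfl⟩ := List.mem_map.1 (hT ▸ hτ)
    exact Submonoid.subset_closure ⟨t, (P.mem_list t).1 ht, (toMat_ofMat t.mat).symm⟩

theorem not_nonTorsion_of_finite (hV : V.HasFiniteMonoid)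
    {A : Matrix (Fin V.dim) (Fin V.dim) ℤ} (hA : A ∈ V.monoid) : ¬ NonTorsion V.dim (ofMat A) := by
  rw [nonTorsion_ofMat_iff, not_and, not_not]
  intro h3
  have : Finite V.monoid := hV
  obtain ⟨i, j, hij, h⟩ := Finite.exists_ne_map_eq_of_infinite
    fun k : ℕ => (⟨A, hA⟩ : V.monoid) ^ k
  wlog hlt : i < j generalizing i j
  · exact this j i hij.symm h.symm (by omega)
  have h' : A ^ i = A ^ j := by simpa using congrArg Subtype.val h
  choose C hC using h3
  refine pow_card_succ_eq_of_torsion (Y := A) (C := .of C) (a := i) (b := j - i) (by omega) ?_ ?_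
  · rw [Nat.add_sub_cancel' hlt.le, h']
  · ext p q
    rw [hC]
    simp

/-- Soundness needs no bound. For completeness, a run is turned into a walk, shortened, and turned
back. -/
theorem Presentation.shortReach_code_iff (hV : V.HasFiniteMonoid) (c c' : V.Config) {t : ℕ}
    (ht : Saturated V.dim (P.list.map P.codeTransition) t) :
    ShortReach (P.code c c') t ↔ V.Reaches c c' := by
  set T := P.list.map P.codeTransition with hT
  set L := monoidLevel V.dim T t with hL
  set B := weightBound V.dim T L (List.ofFn c.2) (List.ofFn c'.2) with hB
  change P.codeConfig c' ∈ configLevel V.dim T (P.codeConfig c)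
    (walkBound (P.numStates * L.length) V.dim B) ↔ _
  rw [P.mem_configLevel_iff]
  constructor
  · rintro ⟨c'', w, -, hw, hrun, h⟩
    rw [P.codeConfig_injective h] at hrun
    exact ⟨w, hw, hrun⟩
  rintro ⟨w, hw, hrun⟩
  -- Finiteness of the monoid excludes the nontorsion alternative, so the search stopped by closure.
  have hclosed : ∀ A ∈ monoidLevel V.dim T (t + 1), A ∈ L := by
    rcases ht with h | ⟨A, hA, h⟩
    · exact h
    · obtain ⟨w, -, rfl⟩ := (mem_monoidLevel_iff _ _ _).1 hA
      exact absurd h (not_nonTorsion_of_finite hV (mem_monoid_of_wordProd P hT w))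
  set S : Set (Matrix (Fin V.dim) (Fin V.dim) ℤ) := {A | ofMat A ∈ L} with hS
  have hS1 : 1 ∈ S := (mem_monoidLevel_iff _ _ _).2 ⟨[], by simp, by simp⟩
  have hSmul : ∀ A ∈ S, ∀ t ∈ V.transitions, A * t.mat ∈ S := by
    intro A hA τ hτ
    apply hclosed
    rw [monoidLevel_succ, monoidStep]
    refine List.mem_append_right _ (List.mem_flatMap.2 ⟨_, hA, List.mem_map.2
      ⟨P.codeTransition τ, List.mem_map.2 ⟨τ, (P.mem_list τ).2 hτ, rfl⟩, ?_⟩⟩)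
    rw [rowsMul_eq, toMat_ofMat]
    exact congrArg (fun M => ofMat (A * M)) (toMat_ofMat τ.mat)
  obtain ⟨A, l, b, hW, hb⟩ := exists_walk_of_run hSmul hS1 hw hrun
  have hinj : Function.Injective fun A : S => (⟨ofMat A.1, List.mem_toFinset.2 A.2⟩ : L.toFinset) :=
    fun A A' h => Subtype.ext (ofMat_injective (congrArg Subtype.val h))
  have : Finite S := Finite.of_injective _ hinj
  have := V.finite_state
  have hcard : Nat.card (V.State × S) ≤ P.numStates * L.length := by
    rw [Nat.card_prod, Nat.card_congr P.numbering, Nat.card_fin]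
    refine Nat.mul_le_mul_left _ ((Nat.card_le_card_of_injective _ hinj).trans ?_)
    rw [Nat.card_eq_fintype_card, Fintype.card_coe]
    exact L.toFinset_card_le
  have hle : ∀ A ∈ S, (∀ τ ∈ V.transitions,
      vecNorm (List.ofFn (Matrix.mulVec A τ.vec)) ≤ B) ∧
      vecNorm (List.ofFn (Matrix.mulVec A c.2)) + vecNorm (List.ofFn c'.2) ≤ B := by
    intro A hA
    have h0 := List.single_le_sum (by simp) _ (List.mem_map_of_mem
      (f := fun A => (T.map fun τ => vecNorm (rowsMulVec V.dim A τ.2.2.1)).sum +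
        vecNorm (rowsMulVec V.dim A (List.ofFn c.2))) hA)
    have hBdef : B = (L.map fun A => (T.map fun τ => vecNorm (rowsMulVec V.dim A τ.2.2.1)).sum +
        vecNorm (rowsMulVec V.dim A (List.ofFn c.2))).sum + vecNorm (List.ofFn c'.2) := rfl
    rw [rowsMulVec_eq] at h0
    refine ⟨fun τ hτ => ?_, by omega⟩
    have h2 := List.single_le_sum (by simp) _ (List.mem_map_of_mem
      (f := fun τ : TransitionCode => vecNorm (rowsMulVec V.dim (ofMat A) τ.2.2.1))
      (List.mem_map_of_mem (f := P.codeTransition) ((P.mem_list τ).2 hτ)))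
    have h3 : rowsMulVec V.dim (ofMat A) (P.codeTransition τ).2.2.1 =
      List.ofFn (Matrix.mulVec A τ.vec) := rowsMulVec_eq A τ.vec
    rw [h3] at h2
    change _ ≤ (T.map fun τ => vecNorm (rowsMulVec V.dim (ofMat A) τ.2.2.1)).sum at h2
    omega
  obtain ⟨l', hl', hW'⟩ := hW.exists_short hcard (B := B) (by
    rintro x a y ⟨τ, hτ, -, -, -, rfl⟩ i
    exact (abs_le_vecNorm _ i).trans (by exact_mod_cast (hle _ y.2.2).1 τ hτ)) (by
    intro i
    have e1 : b i = c'.2 i - Matrix.mulVec A.1 c.2 i := by rw [hb, Pi.add_apply]; ring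
    have e2 := abs_le_vecNorm c'.2 i
    have e3 := abs_le_vecNorm (Matrix.mulVec A.1 c.2) i
    have e4 : (vecNorm (List.ofFn (Matrix.mulVec A.1 c.2)) : ℤ) + vecNorm (List.ofFn c'.2) ≤ B := by
      exact_mod_cast (hle _ A.2).2
    rw [e1]
    refine (abs_sub _ _).trans ?_
    linarith)
  obtain ⟨w', hlen, hw', hrun'⟩ := exists_run_of_walk hW' rfl c.2
  refine ⟨c', w', hlen ▸ hl', hw', ?_, rfl⟩
  rw [← hb] at hrun'
  exact hrun'

end AffineZVASS

/-! ### The decision procedure. -/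

theorem mainTheorem10 :
    ∃ D : ReachCode → Prop, ComputablePred D ∧
      ∀ V : AffineZVASS, V.HasFiniteMonoid →
        ∀ (P : V.Presentation) (c c' : V.Config), D (P.code c c') ↔ V.Reaches c c' := by
  classical
  have hsat : ComputablePred fun p : ReachCode × ℕ => Saturated p.1.1 p.1.2.2.1 p.2 :=
    (primrecPred_saturated (Primrec.fst.comp Primrec.fst)
      (Primrec.fst.comp (Primrec.snd.comp (Primrec.snd.comp Primrec.fst))) Primrec.snd).computablePred
  have hex : ∀ x : ReachCode, ∃ t, Saturated x.1 x.2.2.1 t := fun x => exists_saturated _ _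
  have hfind := Computable.find (P := fun (x : ReachCode) t => Saturated x.1 x.2.2.1 t) hsat hex
  -- An unbounded search for the first saturated level, followed by a primitive recursive test.
  refine ⟨fun x => ShortReach x (Nat.find (hex x)), ?_, ?_⟩
  · exact Computable.computablePred
      (primrecRel_shortReach.decide.to_comp.comp Computable.id hfind)
  · intro V hV P c c'
    exact P.shortReach_code_iff hV c c' (Nat.find_spec (hex (P.code c c')))
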